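/- Let $m,n\ge 0$ be integers and let $P_{m,n}=\mathbb Z[x_1^{\pm1},\dots,x_m^{\pm1},y_1^{\pm1},\dots,y_n^{\pm1}]$. Write $[F]_0$ for the constant term, $F\mapsto F^*$ for the automorphism with $x_i^*=x_i^{-1}$, $y_j^*=y_j^{-1}$, and $$\Delta(x)=\prod_{i>j}\Bigl(1-\frac{x_i}{x_j}\Bigr),\quad \Delta(y)=\prod_{i>j}\Bigl(1-\frac{y_i}{y_j}\Bigr),\quad \Delta(x,y)=\prod_{i,j}\Bigl(1+\frac{y_j}{x_i}\Bigr).$$ For $p,q\in P_{m,n}$ put $$(p,q)=\frac1{m!\,n!}\left[p^*q\,\frac{\Delta(x)\Delta(x)^*\Delta(y)\Delta(y)^*}{\Delta(x,y)\Delta(x,y)^*}\right]_0,$$ where $(\Delta(x,y)\Delta(x,y)^*)^{-1}$ means $\frac{(y_1\cdots y_n)^m}{(x_1\cdots x_m)^n}\prod_{i,j}(1+y_j/x_i)^{-2}$, expanded in powers of the $y_j/x_i$. Let $r,s$ be integers with $0\le r\le m$, $0\le s\le n$, $r-s=m-n$. To a pair $(A,B)$ of finite subsets of $\mathbb Z$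 with $|A|=r$, $|B|=s$ associate its diagram $g:\mathbb Z\to\{\times,\circ,>,<\}$, equal to $\times$ on $A\cap B$, to $>$ on $A\setminus B$, to $<$ on $B\setminus A$ and to $\circ$ elsewhere, and the non-increasing integer sequences $\tau=(\tau_1,\dots,\tau_r)$, $\nu=(\nu_1,\dots,\nu_s)$ determined by $$A=\{\tau_1,\tau_2-1,\dots,\tau_r+1-r\},\qquad B=\{s-r-\nu_s,\dots,2-r-\nu_2,1-r-\nu_1\}.$$ The Euler character $\mathrm{ch}\,E(g)\in P_{m,n}$ of $\mathfrak{gl}(m,n)$ is the Laurent polynomial given by $$\mathrm{ch}\,E(g)\,\Delta(x)x^{\rho_m}\Delta(y)y^{\rho_n}=\Bigl\{\prod_{i\le r,\ j\le n}\Bigl(1+\frac{y_j}{x_i}\Bigr)\prod_{i>r,\ j\le s}\Bigl(1+\frac{x_i}{y_j}\Bigr)\,x_1^{\tau_1}\cdots x_r^{\tau_r}\,y_1^{\nu_1}\cdots y_s^{\nu_s}\,x^{\rho_m}y^{\rho_n}\Bigr\},$$ with $\rho_k=(k-1,k-2,\dots,0)$ and $\{F\}=\sum_{w\in S_m\times S_n}\varepsilon(w)\,w(F)$,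 $\varepsilon(w)$ being the sign of $w$. Likewise a diagram $f$ of a pair $(\tilde A,\tilde B)$ with $|\tilde A|=m$, $|\tilde B|=n$ corresponds to non-increasing sequences $\lambda=(\lambda_1,\dots,\lambda_m)$, $\mu=(\mu_1,\dots,\mu_n)$ (same formulas with $(m,n)$ in place of $(r,s)$), and the character of the Kac module $K(f)$ is $\mathrm{ch}\,K(f)=\Delta(x,y)s_\lambda(x)s_\mu(y)$, with $s_\lambda,s_\mu$ the (Laurent) Schur functions. For a finite set $C\subset g^{-1}(\circ)$ let $g*C$ be the diagram obtained from $g$ by replacing the symbol $\circ$ by $\times$ at all points of $C$. For disjoint finite sets $X,Y\subset\mathbb Z$ let $\varepsilon(X,Y)$ be the sign of the permutation which puts the sequence consisting of the elements of $X$ in decreasing order followed by the elements of $Y$ in decreasing order into decreasing order. Let $S(C)$ be the sum of the elements of $C$. **Theorem.** Let $f$ be the diagram of a pair $(\tilde A,\tilde B)$ with $|\tilde A|=m$, $|\tilde B|=n$, and let $g$ be the diagram of a pair $(A,B)$ with $|A|=r$, $|B|=s$, where $0\le r\le m$, $0\le s\le n$, $r-s=m-n$. Then $(\mathrm{ch}\,K(f),\mathrm{ch}\,E(g))\neq0$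 if and only if $f=g*C$ for some $C\subset g^{-1}(\circ)\cap\mathbb Z_{\le n-m}$, and in that case $$(\mathrm{ch}\,K(f),\mathrm{ch}\,E(g))=(-1)^{\frac12r(r-1)+\frac12m(m-1)+s(m-r)+S(C)}\,\varepsilon(A,C)\,\varepsilon(C,B).$$ -/

import Mathlib

noncomputable section

namespace GLSuper

/-! ### Laurent polynomials -/

/-- Exponents `(a, b)` of the Laurent monomials `x^a y^b` in `x_1, …, x_m, y_1, …, y_n`. -/
abbrev Expo (m n : ℕ) : Type := (Fin m → ℤ) × (Fin n → ℤ)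

/-- The ring `P_{m,n} = ℤ[x_1^{±1}, …, x_m^{±1}, y_1^{±1}, …, y_n^{±1}]`. -/
abbrev LRing (m n : ℕ) : Type := AddMonoidAlgebra ℤ (Expo m n)

variable {m n : ℕ}

/-- A Laurent monomial, as a unit of the ring of Laurent polynomials. -/
def monoUnit (e : Expo m n) : (LRing m n)ˣ where
  val := AddMonoidAlgebra.single e 1
  inv := AddMonoidAlgebra.single (-e) 1
  val_inv := by
    rw [AddMonoidAlgebra.single_mul_single, add_neg_cancel, one_mul]; rfl
  inv_val := by
    rw [AddMonoidAlgebra.single_mul_single, neg_add_cancel, one_mul]; rfl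

variable (m n) in
/-- The variables `x_i`. -/
def x (i : Fin m) : (LRing m n)ˣ := monoUnit (Pi.single i 1, 0)

variable (m n) in
/-- The variables `y_j`. -/
def y (j : Fin n) : (LRing m n)ˣ := monoUnit (0, Pi.single j 1)

/-- The constant term `[F]_0`. -/
def constTerm (F : LRing m n) : ℤ := F.coeff 0

/-- The automorphism `F ↦ F^*`, `x_i^* = x_i⁻¹`, `y_j^* = y_j⁻¹`. -/
def invol : LRing m n ≃ₐ[ℤ] LRing m n :=
  AddMonoidAlgebra.domCongr ℤ ℤ (AddEquiv.neg (Expo m n))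

/-- The action of `S_m × S_n`: the automorphism `x_i ↦ x_{σ i}`, `y_j ↦ y_{τ j}`. -/
def permute (σ : Equiv.Perm (Fin m)) (τ : Equiv.Perm (Fin n)) : LRing m n ≃ₐ[ℤ] LRing m n :=
  AddMonoidAlgebra.domCongr ℤ ℤ
    (AddEquiv.prodCongr (AddEquiv.arrowCongr σ (AddEquiv.refl ℤ))
      (AddEquiv.arrowCongr τ (AddEquiv.refl ℤ)))

/-- The alternation `{F} = ∑_{w ∈ S_m × S_n} ε(w) w(F)`. -/
def alternation (F : LRing m n) : LRing m n :=
  ∑ σ : Equiv.Perm (Fin m), ∑ τ : Equiv.Perm (Fin n),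
    ((Equiv.Perm.sign σ * Equiv.Perm.sign τ : ℤˣ) : ℤ) • permute σ τ F

/-! ### Vandermonde products and Schur functions -/

section Generic

variable {R : Type*} [CommRing R] {k : ℕ}

/-- `Δ(u) = ∏_{i > j} (1 - u_i / u_j)`. -/
def delta (u : Fin k → Rˣ) : R :=
  ∏ i, ∏ j ∈ Finset.Iio i, (1 - ((u i / u j : Rˣ) : R))

/-- `u^{ρ_k}` with `ρ_k = (k - 1, k - 2, …, 0)`. -/
def rhoMono (u : Fin k → Rˣ) : Rˣ :=
  ∏ i, u i ^ ((k : ℤ) - 1 - (i : ℤ))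

/-- `∏_{i < j} (u_i - u_j)`. -/
def vdm (u : Fin k → Rˣ) : R :=
  ∏ i, ∏ j ∈ Finset.Ioi i, ((u i : R) - (u j : R))

/-- The bialternant numerator `det (u_i^{α_j})`. -/
def alternant (u : Fin k → Rˣ) (α : Fin k → ℤ) : R :=
  Matrix.det (Matrix.of fun i j : Fin k => ((u i ^ α j : Rˣ) : R))

theorem vdm_eq (u : Fin k → Rˣ) : delta u * (rhoMono u : R) = vdm u := by
  have h1 : delta u = ∏ i, ∏ j ∈ Finset.Ioi i, (1 - ((u j / u i : Rˣ) : R)) := by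
    unfold delta
    rw [Finset.prod_comm' (t' := Finset.univ) (s' := fun j => Finset.Ioi j)]
    intro a b
    simp
  have h2 : ((rhoMono u : Rˣ) : R) = ∏ i, ∏ _j ∈ Finset.Ioi i, (u i : R) := by
    unfold rhoMono
    rw [Units.coe_prod]
    refine Finset.prod_congr rfl fun i _ => ?_
    have hk : (k : ℤ) - 1 - (i : ℤ) = ((k - 1 - (i : ℕ) : ℕ) : ℤ) := by
      have := i.2
      omega
    rw [Finset.prod_const, Fin.card_Ioi, hk, zpow_natCast, Units.val_pow_eq_pow_val]
  rw [h1, h2, vdm, ← Finset.prod_mul_distrib]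
  refine Finset.prod_congr rfl fun i _ => ?_
  rw [← Finset.prod_mul_distrib]
  refine Finset.prod_congr rfl fun j _ => ?_
  rw [sub_mul, one_mul, ← Units.val_mul, div_mul_cancel]

theorem vdm_dvd_det_eval (u : Fin k → Rˣ) (f : Fin k → Polynomial R) :
    vdm u ∣ Matrix.det (Matrix.of fun i j : Fin k => (f j).eval (u i : R)) := by
  nontriviality R
  set q : Polynomial R := ∏ i, (Polynomial.X - Polynomial.C (u i : R)) with hq
  have hmonic : q.Monic := Polynomial.monic_prod_of_monic _ _ fun i _ => Polynomial.monic_X_sub_C _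
  have hdeg : q.natDegree = k := by
    rw [hq, Polynomial.natDegree_prod_of_monic _ _ fun i _ => Polynomial.monic_X_sub_C _]
    simp
  have hroot : ∀ i, q.eval (u i : R) = 0 := fun i => by
    rw [hq, Polynomial.eval_prod]
    exact Finset.prod_eq_zero (Finset.mem_univ i) (by simp)
  have hmat : (Matrix.of fun i j : Fin k => (f j).eval (u i : R)) =
      Matrix.vandermonde (fun i => (u i : R)) *
        Matrix.of fun l j : Fin k => (f j %ₘ q).coeff l := by
    ext i j
    have h1 : (f j).eval (u i : R) = (f j %ₘ q).eval (u i : R) := by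
      conv_lhs => rw [← Polynomial.modByMonic_add_div (f j) q]
      simp [hroot]
    have h2 : (f j %ₘ q).degree < (k : ℕ) := by
      have := Polynomial.degree_modByMonic_lt (f j) hmonic
      rwa [Polynomial.degree_eq_natDegree hmonic.ne_zero, hdeg] at this
    have h3 : (f j %ₘ q).eval (u i : R) =
        ∑ l ∈ Finset.range k, (f j %ₘ q).coeff l * (u i : R) ^ l := by
      by_cases h0 : f j %ₘ q = 0
      · simp [h0]
      · exact Polynomial.eval_eq_sum_range' ((Polynomial.natDegree_lt_iff_degree_lt h0).2 h2) _
    rw [Matrix.of_apply, h1, h3, Matrix.mul_apply, Finset.sum_range]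
    simp [Matrix.vandermonde_apply, mul_comm]
  rw [hmat, Matrix.det_mul, Matrix.det_vandermonde]
  refine Dvd.dvd.mul_right ?_ _
  unfold vdm
  refine Finset.prod_dvd_prod_of_dvd _ _ fun i _ => Finset.prod_dvd_prod_of_dvd _ _ fun j _ => ?_
  exact ⟨-1, by ring⟩

theorem vdm_dvd_alternant (u : Fin k → Rˣ) (α : Fin k → ℤ) : vdm u ∣ alternant u α := by
  obtain ⟨N, hN⟩ : ∃ N : ℕ, ∀ j, 0 ≤ α j + (N : ℤ) := by
    refine ⟨∑ j, (α j).natAbs, fun j => ?_⟩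
    have : (α j).natAbs ≤ ∑ j, (α j).natAbs :=
      Finset.single_le_sum (f := fun j => (α j).natAbs) (fun _ _ => Nat.zero_le _)
        (Finset.mem_univ j)
    omega
  have h := vdm_dvd_det_eval u fun j => (Polynomial.X : Polynomial R) ^ (α j + (N : ℤ)).toNat
  have hmat : (Matrix.of fun i j : Fin k =>
      ((Polynomial.X : Polynomial R) ^ (α j + (N : ℤ)).toNat).eval (u i : R)) =
      Matrix.of fun i j : Fin k => ((u i ^ N : Rˣ) : R) * ((u i ^ α j : Rˣ) : R) := by
    ext i j
    have hj : u i ^ (α j + (N : ℤ)).toNat = u i ^ N * u i ^ α j := by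
      rw [← zpow_natCast, Int.toNat_of_nonneg (hN j), zpow_add, zpow_natCast, mul_comm]
    simp only [Matrix.of_apply, Polynomial.eval_pow, Polynomial.eval_X]
    rw [← Units.val_pow_eq_pow_val, hj, Units.val_mul]
  have hdet := Matrix.det_mul_column (fun i : Fin k => ((u i ^ N : Rˣ) : R))
    (Matrix.of fun i j : Fin k => ((u i ^ α j : Rˣ) : R))
  simp only [Matrix.of_apply] at hdet
  rw [hmat, hdet, ← Units.coe_prod] at h
  exact (Units.dvd_mul_left).1 h

/-- The Schur function `s_λ(u) = det (u_i^{λ_j + k - j}) / ∏_{i < j} (u_i - u_j)`. -/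
def schur (u : Fin k → Rˣ) (lam : Fin k → ℤ) : R :=
  (vdm_dvd_alternant u fun j => lam j + ((k : ℤ) - 1 - (j : ℤ))).choose

theorem schur_spec (u : Fin k → Rˣ) (lam : Fin k → ℤ) :
    schur u lam * vdm u = alternant u fun j => lam j + ((k : ℤ) - 1 - (j : ℤ)) := by
  rw [mul_comm]
  exact (vdm_dvd_alternant u fun j => lam j + ((k : ℤ) - 1 - (j : ℤ))).choose_spec.symm

end Generic

variable (m n) in
/-- The denominator `Δ(x) x^{ρ_m} Δ(y) y^{ρ_n}`. -/
def weylDen : LRing m n :=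
  delta (x m n) * (rhoMono (x m n) : LRing m n) * delta (y m n) * (rhoMono (y m n) : LRing m n)

theorem monoUnit_eq (e : Expo m n) :
    monoUnit e = (∏ i, x m n i ^ e.1 i) * ∏ j, y m n j ^ e.2 j := by
  let φ : Multiplicative (Expo m n) →* (LRing m n)ˣ :=
    { toFun := fun e => monoUnit e.toAdd
      map_one' := Units.ext rfl
      map_mul' := fun a b => Units.ext (by
        change AddMonoidAlgebra.single (a.toAdd + b.toAdd) (1 : ℤ) =
          AddMonoidAlgebra.single a.toAdd 1 * AddMonoidAlgebra.single b.toAdd 1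
        rw [AddMonoidAlgebra.single_mul_single, one_mul]) }
  have hx : ∀ i, x m n i = φ (Multiplicative.ofAdd (Pi.single i 1, 0)) := fun i => rfl
  have hy : ∀ j, y m n j = φ (Multiplicative.ofAdd (0, Pi.single j 1)) := fun j => rfl
  have he : monoUnit e = φ (Multiplicative.ofAdd e) := rfl
  simp only [hx, hy, he, ← map_zpow, ← map_prod, ← map_mul]
  congr 1
  simp only [← ofAdd_zsmul, ← ofAdd_sum, ← ofAdd_add]
  congr 1
  ext i <;> simp [Prod.fst_sum, Prod.snd_sum, Finset.sum_apply, Pi.single_apply]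

theorem permute_monoUnit (σ : Equiv.Perm (Fin m)) (τ : Equiv.Perm (Fin n)) (e : Expo m n) :
    permute σ τ (monoUnit e : LRing m n) =
      (((∏ i, x m n (σ i) ^ e.1 i) * ∏ j, y m n (τ j) ^ e.2 j : (LRing m n)ˣ) : LRing m n) := by
  have h : permute σ τ (monoUnit e : LRing m n) =
      (monoUnit (e.1 ∘ σ.symm, e.2 ∘ τ.symm) : (LRing m n)ˣ) := by
    unfold permute monoUnit
    rw [AddMonoidAlgebra.domCongr_single]
    rfl
  rw [h, monoUnit_eq]
  congr 2
  · exact (Fintype.prod_equiv σ _ _ fun i => by simp).symm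
  · exact (Fintype.prod_equiv τ _ _ fun i => by simp).symm

theorem alternation_monoUnit (e : Expo m n) :
    alternation (monoUnit e : LRing m n) = alternant (x m n) e.1 * alternant (y m n) e.2 := by
  unfold alternation alternant
  rw [Matrix.det_apply', Matrix.det_apply', Finset.sum_mul_sum]
  refine Finset.sum_congr rfl fun σ _ => Finset.sum_congr rfl fun τ _ => ?_
  rw [permute_monoUnit]
  simp only [Matrix.of_apply, Units.val_mul, Units.coe_prod, zsmul_eq_mul, Int.cast_mul]
  ring

theorem weylDen_eq : weylDen m n = vdm (x m n) * vdm (y m n) := by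
  rw [weylDen, mul_assoc, vdm_eq, vdm_eq]

theorem weylDen_dvd_alternation (F : LRing m n) : weylDen m n ∣ alternation F := by
  induction F using AddMonoidAlgebra.induction_linear with
  | zero => simp [alternation]
  | add F G hF hG =>
    have : alternation (F + G) = alternation F + alternation G := by
      simp [alternation, smul_add, Finset.sum_add_distrib]
    rw [this]
    exact dvd_add hF hG
  | single e c =>
    have h1 : (AddMonoidAlgebra.single e c : LRing m n) = c • (monoUnit e : LRing m n) := by
      simp [monoUnit]
    have h2 : alternation (c • (monoUnit e : LRing m n)) =
        c • alternation (monoUnit e : LRing m n) := by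
      simp only [alternation, map_zsmul, Finset.smul_sum]
      simp only [smul_comm c]
    rw [h1, h2, alternation_monoUnit, weylDen_eq, zsmul_eq_mul]
    exact (mul_dvd_mul (vdm_dvd_alternant _ _) (vdm_dvd_alternant _ _)).mul_left _

/-- The quotient `{F} / (Δ(x) x^{ρ_m} Δ(y) y^{ρ_n})`, which is a Laurent polynomial. -/
def alternationQuot (F : LRing m n) : LRing m n := (weylDen_dvd_alternation F).choose

theorem alternationQuot_spec (F : LRing m n) :
    alternationQuot F * weylDen m n = alternation F := by
  rw [mul_comm]
  exact (weylDen_dvd_alternation F).choose_spec.symm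

/-! ### The bilinear form -/

variable (m n) in
/-- `Δ(x, y) = ∏_{i, j} (1 + y_j / x_i)`. -/
def deltaXY : LRing m n :=
  ∏ i, ∏ j, (1 + ((y m n j / x m n i : (LRing m n)ˣ) : LRing m n))

variable (m n) in
/-- The expansion of `∏_{i, j} (1 + t y_j / x_i)^{-2}` as a power series in `t`.  Its coefficient
at `t^d` is the part of degree `d` in `y` of the expansion of `∏_{i, j} (1 + y_j / x_i)^{-2}` in
powers of the `y_j / x_i`. -/
def expansion : PowerSeries (LRing m n) :=
  (PowerSeries.invOfUnit
    (∏ i, ∏ j, (1 + PowerSeries.C ((y m n j / x m n i : (LRing m n)ˣ) : LRing m n) *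
      PowerSeries.X)) 1) ^ 2

variable (m n) in
/-- `(y_1 ⋯ y_n)^m / (x_1 ⋯ x_m)^n`. -/
def prefactor : (LRing m n)ˣ :=
  (∏ j, y m n j) ^ m / (∏ i, x m n i) ^ n

/-- The constant term of `F / (Δ(x, y) Δ(x, y)^*)`, where `(Δ(x, y) Δ(x, y)^*)⁻¹` is read as
`(y_1 ⋯ y_n)^m / (x_1 ⋯ x_m)^n * ∏ (1 + y_j / x_i)^{-2}`, expanded in powers of the `y_j / x_i`.
Only finitely many `d` contribute, as the degrees in `y` of the monomials of `F` are bounded. -/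
def constTermDiv (F : LRing m n) : ℤ :=
  ∑ᶠ d : ℕ, constTerm
    (F * (prefactor m n : LRing m n) * PowerSeries.coeff d (expansion m n))

/-- The bilinear form
`(p, q) = (1 / (m! n!)) [p^* q Δ(x) Δ(x)^* Δ(y) Δ(y)^* / (Δ(x, y) Δ(x, y)^*)]_0`. -/
def pairing (p q : LRing m n) : ℚ :=
  (1 / (m.factorial : ℚ)) * (1 / (n.factorial : ℚ)) *
    (constTermDiv (invol p * q * (delta (x m n) * invol (delta (x m n))) *
      (delta (y m n) * invol (delta (y m n)))) : ℚ)

/-! ### Diagrams -/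

/-- The symbols `×`, `∘`, `>`, `<`. -/
inductive Symbol
  | cross
  | circ
  | gt
  | lt

/-- The `i`-th largest element of a finite set of integers. -/
def decr (X : Finset ℤ) (i : Fin X.card) : ℤ := X.orderEmbOfFin rfl i.rev

/-- Pairs `(A, B)` of finite sets of integers with `|A| = p`, `|B| = q`. -/
structure Diagram (p q : ℕ) where
  A : Finset ℤ
  B : Finset ℤ
  cardA : A.card = p
  cardB : B.card = q

namespace Diagram

variable {p q : ℕ}

/-- The diagram of `(A, B)` as a function on `ℤ`. -/
def symbol (h : Diagram p q) (z : ℤ) : Symbol :=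
  if z ∈ h.A then (if z ∈ h.B then Symbol.cross else Symbol.gt)
  else (if z ∈ h.B then Symbol.lt else Symbol.circ)

/-- The sequence `λ` with `A = {λ_1, λ_2 - 1, …, λ_p + 1 - p}`. -/
def lam (h : Diagram p q) (i : Fin p) : ℤ :=
  h.A.orderEmbOfFin h.cardA i.rev + (i : ℤ)

/-- The sequence `μ` with `B = {q - p - μ_q, …, 2 - p - μ_2, 1 - p - μ_1}`. -/
def mu (h : Diagram p q) (j : Fin q) : ℤ :=
  (j : ℤ) + 1 - (p : ℤ) - h.B.orderEmbOfFin h.cardB j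

theorem lam_antitone (h : Diagram p q) : Antitone h.lam := by
  cases p with
  | zero => exact fun i => i.elim0
  | succ p =>
    refine Fin.antitone_iff_succ_le.2 fun i => ?_
    have : h.A.orderEmbOfFin h.cardA i.succ.rev < h.A.orderEmbOfFin h.cardA i.castSucc.rev :=
      (h.A.orderEmbOfFin h.cardA).strictMono (Fin.rev_lt_rev.2 i.castSucc_lt_succ)
    simp only [lam, Fin.val_succ, Fin.val_castSucc]
    push_cast
    omega

theorem mu_antitone (h : Diagram p q) : Antitone h.mu := by
  cases q with
  | zero => exact fun i => i.elim0
  | succ q =>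
    refine Fin.antitone_iff_succ_le.2 fun i => ?_
    have : h.B.orderEmbOfFin h.cardB i.castSucc < h.B.orderEmbOfFin h.cardB i.succ :=
      (h.B.orderEmbOfFin h.cardB).strictMono i.castSucc_lt_succ
    simp only [mu, Fin.val_succ, Fin.val_castSucc]
    push_cast
    omega

theorem image_lam (h : Diagram p q) :
    Finset.univ.image (fun i : Fin p => h.lam i - (i : ℤ)) = h.A := by
  ext z
  have hz : z ∈ h.A ↔ z ∈ Set.range (h.A.orderEmbOfFin h.cardA) := by
    rw [Finset.range_orderEmbOfFin, Finset.mem_coe]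
  simp only [lam, add_sub_cancel_right, Finset.mem_image, Finset.mem_univ, true_and]
  rw [hz, Set.mem_range]
  exact Fin.revPerm.exists_congr_left.trans (by simp)

theorem image_mu (h : Diagram p q) :
    Finset.univ.image (fun j : Fin q => (j : ℤ) + 1 - (p : ℤ) - h.mu j) = h.B := by
  ext z
  have hz : z ∈ h.B ↔ z ∈ Set.range (h.B.orderEmbOfFin h.cardB) := by
    rw [Finset.range_orderEmbOfFin, Finset.mem_coe]
  simp only [mu, sub_sub_cancel, Finset.mem_image, Finset.mem_univ, true_and]
  rw [hz, Set.mem_range]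

end Diagram

/-- The diagram `h * C`: the points of `C` (a set of `∘`'s of `h`) are turned into `×`'s. -/
def star (h : ℤ → Symbol) (C : Finset ℤ) (z : ℤ) : Symbol :=
  if z ∈ C then Symbol.cross else h z

/-- `ε(X, Y)`: the sign of the permutation that puts the sequence
`(x_1 > x_2 > ⋯, y_1 > y_2 > ⋯)` into decreasing order. -/
def shuffleSign (X Y : Finset ℤ) : ℤˣ :=
  Equiv.Perm.sign (Tuple.sort fun i => -(Fin.append (decr X) (decr Y) i))

/-! ### Characters -/

/-- The character of the Kac module `K(f)`: `ch K(f) = Δ(x, y) s_λ(x) s_μ(y)`. -/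
def chK (f : Diagram m n) : LRing m n :=
  deltaXY m n * schur (x m n) f.lam * schur (y m n) f.mu

variable (m n) in
/-- `∏_{(i,j) ∈ D₊} (1 + y_j / x_i) ∏_{(i,j) ∈ D₋} (1 + x_i / y_j)` with `D₊ = [1,r] × [1,n]` and
`D₋ = [r+1,m] × [1,s]`. -/
def eulerFactor (r s : ℕ) : LRing m n :=
  (∏ i : Fin m, ∏ j : Fin n, if (i : ℕ) < r then
      1 + ((y m n j / x m n i : (LRing m n)ˣ) : LRing m n) else 1) *
  (∏ i : Fin m, ∏ j : Fin n, if r ≤ (i : ℕ) ∧ (j : ℕ) < s then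
      1 + ((x m n i / y m n j : (LRing m n)ˣ) : LRing m n) else 1)

variable (m n) in
/-- The Euler character `ch E(g)` for `gl(m,n)`, `g = (A, B)` with `|A| = r ≤ m`, `|B| = s ≤ n`:
`ch E(g) Δ(x) x^{ρ_m} Δ(y) y^{ρ_n} =
  {∏_{D₊} (1 + y_j / x_i) ∏_{D₋} (1 + x_i / y_j) x^τ y^ν x^{ρ_m} y^{ρ_n}}`. -/
def chE {r s : ℕ} (hr : r ≤ m) (hs : s ≤ n) (g : Diagram r s) : LRing m n :=
  alternationQuot
    (eulerFactor m n r s *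
      ((∏ i : Fin r, x m n (Fin.castLE hr i) ^ g.lam i : (LRing m n)ˣ) : LRing m n) *
      ((∏ j : Fin s, y m n (Fin.castLE hs j) ^ g.mu j : (LRing m n)ˣ) : LRing m n) *
      (rhoMono (x m n) : LRing m n) * (rhoMono (y m n) : LRing m n))

end GLSuper

end

noncomputable section

namespace GLSuper

variable {m n : ℕ}

/-! ### Constant terms of homogeneous series -/

variable (m n) in
/-- The total degree in `y` of an exponent. -/
def yDegree : Expo m n →+ ℤ where
  toFun e := ∑ j, e.2 j
  map_zero' := by simp
  map_add' a b := by simp [Finset.sum_add_distrib]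

variable (m n) in
/-- The power series in `t` whose coefficient at `t^d` is homogeneous of degree `d` in `y`. -/
def homogeneousSeries : Submonoid (PowerSeries (LRing m n)) where
  carrier := {S | ∀ d : ℕ, PowerSeries.coeff d S ∈ AddMonoidAlgebra.gradeBy ℤ (yDegree m n) (d : ℤ)}
  one_mem' d := by
    rw [PowerSeries.coeff_one]
    split_ifs with h
    · subst h
      exact SetLike.GradedOne.one_mem (A := AddMonoidAlgebra.gradeBy ℤ (yDegree m n))
    · exact zero_mem _
  mul_mem' {S T} hS hT d := by
    rw [PowerSeries.coeff_mul]
    refine sum_mem fun p hp => ?_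
    have := SetLike.GradedMul.mul_mem (hS p.1) (hT p.2)
    rwa [← Nat.cast_add, Finset.HasAntidiagonal.mem_antidiagonal.1 hp] at this

/-- The constant term of `F * S(1)` for a homogeneous power series `S`. -/
def seriesTerm (F : LRing m n) (S : PowerSeries (LRing m n)) : ℤ :=
  ∑ᶠ d : ℕ, constTerm (F * PowerSeries.coeff d S)

theorem constTerm_add (F G : LRing m n) : constTerm (F + G) = constTerm F + constTerm G := rfl

theorem constTerm_zero : constTerm (0 : LRing m n) = 0 := rfl

theorem constTerm_single_mul (e : Expo m n) (c : ℤ) (G : LRing m n) :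
    constTerm (AddMonoidAlgebra.single e c * G) = c * G.coeff (-e) := by
  rw [constTerm, AddMonoidAlgebra.coeff_single_mul_apply, add_zero]

theorem finite_support_constTerm (F : LRing m n) {S : PowerSeries (LRing m n)}
    (hS : S ∈ homogeneousSeries m n) :
    (Function.support fun d : ℕ => constTerm (F * PowerSeries.coeff d S)).Finite := by
  induction F using AddMonoidAlgebra.induction_linear with
  | zero => simp [constTerm_zero, Function.support]
  | add F G hF hG =>
    refine (hF.union hG).subset ?_
    simp only [add_mul, constTerm_add]
    exact Function.support_add _ _
  | single e c =>
    refine (Set.finite_singleton (yDegree m n (-e)).toNat).subset fun d hd => ?_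
    rw [Function.mem_support, constTerm_single_mul] at hd
    have := hS d (-e) (by rw [Finsupp.mem_support_iff]; exact right_ne_zero_of_mul hd)
    rw [Set.mem_singleton_iff, this, Int.toNat_natCast]

theorem seriesTerm_add {S : PowerSeries (LRing m n)} (hS : S ∈ homogeneousSeries m n)
    (F G : LRing m n) : seriesTerm (F + G) S = seriesTerm F S + seriesTerm G S := by
  simp only [seriesTerm, add_mul, constTerm_add]
  exact finsum_add_distrib (finite_support_constTerm F hS) (finite_support_constTerm G hS)

theorem seriesTerm_zero (S : PowerSeries (LRing m n)) : seriesTerm 0 S = 0 := by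
  simp [seriesTerm, constTerm_zero]

variable (m n) in
/-- `seriesTerm` as an additive map in its first argument. -/
def seriesTermHom {S : PowerSeries (LRing m n)} (hS : S ∈ homogeneousSeries m n) :
    LRing m n →+ ℤ where
  toFun F := seriesTerm F S
  map_zero' := seriesTerm_zero S
  map_add' := seriesTerm_add hS

theorem seriesTerm_sum {S : PowerSeries (LRing m n)} (hS : S ∈ homogeneousSeries m n)
    {ι : Type*} (s : Finset ι) (F : ι → LRing m n) :
    seriesTerm (∑ i ∈ s, F i) S = ∑ i ∈ s, seriesTerm (F i) S :=
  map_sum (seriesTermHom m n hS) F s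

theorem seriesTerm_zsmul {S : PowerSeries (LRing m n)} (hS : S ∈ homogeneousSeries m n)
    (c : ℤ) (F : LRing m n) : seriesTerm (c • F) S = c * seriesTerm F S :=
  (map_zsmul (seriesTermHom m n hS) c F).trans (smul_eq_mul _ _)

variable (m n) in
/-- The ratio `y_j / x_i`. -/
def ratio (i : Fin m) (j : Fin n) : LRing m n := ((y m n j / x m n i : (LRing m n)ˣ) : LRing m n)

theorem ratio_eq (i : Fin m) (j : Fin n) :
    ratio m n i j = AddMonoidAlgebra.single (-Pi.single i 1, Pi.single j 1) 1 := by
  rw [ratio, div_eq_mul_inv, Units.val_mul]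
  change AddMonoidAlgebra.single _ _ * AddMonoidAlgebra.single _ _ = _
  rw [AddMonoidAlgebra.single_mul_single]
  simp

theorem ratio_mem (i : Fin m) (j : Fin n) :
    ratio m n i j ∈ AddMonoidAlgebra.gradeBy ℤ (yDegree m n) 1 := by
  rw [ratio_eq]
  have := AddMonoidAlgebra.single_mem_gradeBy (R := ℤ) (yDegree m n)
    (-Pi.single i 1, Pi.single j 1) 1
  simpa [yDegree] using this

variable (m n) in
/-- The linear series `1 + t y_j / x_i`. -/
def linSeries (i : Fin m) (j : Fin n) : PowerSeries (LRing m n) :=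
  1 + PowerSeries.C (ratio m n i j) * PowerSeries.X

variable (m n) in
/-- The geometric series `(1 + t y_j / x_i)⁻¹`. -/
def geomSeries (i : Fin m) (j : Fin n) : PowerSeries (LRing m n) :=
  PowerSeries.mk fun d => (-ratio m n i j) ^ d

theorem linSeries_mul_geomSeries (i : Fin m) (j : Fin n) :
    linSeries m n i j * geomSeries m n i j = 1 := by
  ext1 d
  rw [linSeries, add_mul, one_mul, mul_assoc, map_add, PowerSeries.coeff_C_mul, geomSeries,
    PowerSeries.coeff_mk, PowerSeries.coeff_one]
  cases d with
  | zero => simp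
  | succ d =>
    rw [PowerSeries.coeff_succ_X_mul, PowerSeries.coeff_mk]
    simp only [Nat.add_eq_zero_iff, one_ne_zero, and_false, if_false]
    ring

theorem geomSeries_mem (i : Fin m) (j : Fin n) :
    geomSeries m n i j ∈ homogeneousSeries m n := by
  intro d
  rw [geomSeries, PowerSeries.coeff_mk]
  have := SetLike.pow_mem_graded d (neg_mem (ratio_mem i j))
  simpa using this

variable (m n) in
/-- The product of the geometric series `(1 + t y_j / x_i)⁻¹` over `(i, j) ∈ Q`. -/
def geomProd (Q : Finset (Fin m × Fin n)) : PowerSeries (LRing m n) :=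
  ∏ q ∈ Q, geomSeries m n q.1 q.2

theorem geomProd_mem (Q : Finset (Fin m × Fin n)) : geomProd m n Q ∈ homogeneousSeries m n :=
  prod_mem fun q _ => geomSeries_mem q.1 q.2

theorem expansion_eq : expansion m n = geomProd m n Finset.univ ^ 2 := by
  have h : (∏ i, ∏ j, linSeries m n i j) * geomProd m n Finset.univ = 1 := by
    rw [geomProd, ← Finset.univ_product_univ, Finset.prod_product, ← Finset.prod_mul_distrib]
    refine Finset.prod_eq_one fun i _ => ?_
    rw [← Finset.prod_mul_distrib]
    exact Finset.prod_eq_one fun j _ => linSeries_mul_geomSeries i j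
  rw [expansion]
  congr 1
  have h' : (∏ i, ∏ j, linSeries m n i j) *
      PowerSeries.invOfUnit (∏ i, ∏ j, linSeries m n i j) 1 = 1 := by
    apply PowerSeries.mul_invOfUnit
    simp [map_prod, linSeries]
  calc PowerSeries.invOfUnit (∏ i, ∏ j, linSeries m n i j) 1
      = PowerSeries.invOfUnit (∏ i, ∏ j, linSeries m n i j) 1 *
        ((∏ i, ∏ j, linSeries m n i j) * geomProd m n Finset.univ) := by rw [h, mul_one]
    _ = ((∏ i, ∏ j, linSeries m n i j) *
      PowerSeries.invOfUnit (∏ i, ∏ j, linSeries m n i j) 1) * geomProd m n Finset.univ := by ring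
    _ = _ := by rw [h', one_mul]

/-- A factor `1 + y_j / x_i` can be moved into the series. -/
theorem seriesTerm_mul_one_add_ratio {S : PowerSeries (LRing m n)}
    (hS : S ∈ homogeneousSeries m n) (F : LRing m n) (i : Fin m) (j : Fin n) :
    seriesTerm (F * (1 + ratio m n i j)) S = seriesTerm F (linSeries m n i j * S) := by
  rw [mul_add, mul_one, seriesTerm_add hS]
  have hfin := finite_support_constTerm (F * ratio m n i j) hS
  set b : ℕ → ℤ := fun d => if d = 0 then 0 else
    constTerm (F * ratio m n i j * PowerSeries.coeff (d - 1) S) with hb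
  have hsupp : Function.support b = Nat.succ '' (Function.support fun d : ℕ =>
      constTerm (F * ratio m n i j * PowerSeries.coeff d S)) := by
    ext d
    cases d <;> simp [hb]
  have h1 : seriesTerm (F * ratio m n i j) S = ∑ᶠ d, b d := by
    rw [seriesTerm, ← finsum_mem_support b, hsupp,
      finsum_mem_image Nat.succ_injective.injOn, ← finsum_mem_support]
    simp [hb]
  rw [h1, seriesTerm, ← finsum_add_distrib (finite_support_constTerm F hS)
    (show (Function.support b).Finite from hsupp ▸ hfin.image _), seriesTerm]
  refine finsum_congr fun d => ?_
  rw [linSeries, add_mul, one_mul, mul_assoc, map_add, PowerSeries.coeff_C_mul, mul_add,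
    constTerm_add]
  cases d with
  | zero => simp [hb, constTerm_zero]
  | succ d => simp [hb, PowerSeries.coeff_succ_X_mul, mul_assoc]

theorem seriesTerm_mul_prod_mul_geomProd {S : PowerSeries (LRing m n)}
    (hS : S ∈ homogeneousSeries m n) (F : LRing m n) (Q : Finset (Fin m × Fin n)) :
    seriesTerm (F * ∏ q ∈ Q, (1 + ratio m n q.1 q.2)) (geomProd m n Q * S) =
      seriesTerm F S := by
  classical
  induction Q using Finset.induction_on generalizing F with
  | empty => simp [geomProd]
  | insert q Q hq ih =>
    rw [Finset.prod_insert hq, mul_comm (1 + _), ← mul_assoc,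
      seriesTerm_mul_one_add_ratio (mul_mem (geomProd_mem _) hS), geomProd,
      Finset.prod_insert hq, ← mul_assoc, ← mul_assoc, linSeries_mul_geomSeries, one_mul]
    exact ih F

theorem seriesTerm_mul_prod (F : LRing m n) {Q T : Finset (Fin m × Fin n)} (h : Q ⊆ T) :
    seriesTerm (F * ∏ q ∈ Q, (1 + ratio m n q.1 q.2)) (geomProd m n T) =
      seriesTerm F (geomProd m n (T \ Q)) := by
  rw [← seriesTerm_mul_prod_mul_geomProd (geomProd_mem (T \ Q)) F Q]
  congr 1
  rw [geomProd, geomProd, geomProd, mul_comm, Finset.prod_sdiff h]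

/-! ### The action of the symmetric groups -/

theorem constTerm_permute (σ : Equiv.Perm (Fin m)) (τ : Equiv.Perm (Fin n)) (F : LRing m n) :
    constTerm (permute σ τ F) = constTerm F := by
  rw [constTerm, permute, AddMonoidAlgebra.coeff_domCongr]
  rfl

theorem permute_x (σ : Equiv.Perm (Fin m)) (τ : Equiv.Perm (Fin n)) (i : Fin m) :
    Units.map (permute σ τ : LRing m n →* LRing m n) (x m n i) = x m n (σ i) := by
  ext1
  refine (permute_monoUnit σ τ _).trans ?_
  simp [Pi.single_apply, apply_ite]

theorem permute_y (σ : Equiv.Perm (Fin m)) (τ : Equiv.Perm (Fin n)) (j : Fin n) :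
    Units.map (permute σ τ : LRing m n →* LRing m n) (y m n j) = y m n (τ j) := by
  ext1
  refine (permute_monoUnit σ τ _).trans ?_
  simp [Pi.single_apply, apply_ite]

theorem permute_ratio (σ : Equiv.Perm (Fin m)) (τ : Equiv.Perm (Fin n)) (i : Fin m) (j : Fin n) :
    permute σ τ (ratio m n i j) = ratio m n (σ i) (τ j) := by
  change ((Units.map (permute σ τ : LRing m n →* LRing m n) (y m n j / x m n i) :
    (LRing m n)ˣ) : LRing m n) = _
  rw [map_div, permute_x, permute_y]
  rfl

theorem map_permute_geomProd (σ : Equiv.Perm (Fin m)) (τ : Equiv.Perm (Fin n))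
    (Q : Finset (Fin m × Fin n)) :
    PowerSeries.map (permute σ τ : LRing m n →+* LRing m n) (geomProd m n Q) =
      geomProd m n (Q.map (σ.prodCongr τ).toEmbedding) := by
  rw [geomProd, geomProd, map_prod, Finset.prod_map]
  refine Finset.prod_congr rfl fun q _ => ?_
  ext1 d
  simp [geomSeries, permute_ratio]

theorem seriesTerm_permute (σ : Equiv.Perm (Fin m)) (τ : Equiv.Perm (Fin n)) (F : LRing m n)
    (Q : Finset (Fin m × Fin n)) :
    seriesTerm (permute σ τ F) (geomProd m n (Q.map (σ.prodCongr τ).toEmbedding)) =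
      seriesTerm F (geomProd m n Q) := by
  rw [← map_permute_geomProd]
  refine finsum_congr fun d => ?_
  rw [PowerSeries.coeff_map]
  refine Eq.trans ?_ (constTerm_permute σ τ _)
  rw [map_mul]
  rfl

/-! ### Reduction of the form to a constant term -/

theorem map_alternant {R R' : Type*} [CommRing R] [CommRing R'] (φ : R →+* R') {k : ℕ}
    (u : Fin k → Rˣ) (α : Fin k → ℤ) :
    φ (alternant u α) = alternant (fun i => Units.map (φ : R →* R') (u i)) α := by
  rw [alternant, RingHom.map_det, alternant]
  congr 1
  ext i j
  simp only [RingHom.mapMatrix_apply, Matrix.map_apply, Matrix.of_apply, ← map_zpow]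
  rfl

theorem alternant_comp_perm {R : Type*} [CommRing R] {k : ℕ} (u : Fin k → Rˣ) (α : Fin k → ℤ)
    (σ : Equiv.Perm (Fin k)) :
    alternant (u ∘ σ) α = (Equiv.Perm.sign σ : ℤ) * alternant u α :=
  Matrix.det_permute σ (Matrix.of fun i j : Fin k => ((u i ^ α j : Rˣ) : R))

theorem invol_monoUnit (e : Expo m n) :
    invol (monoUnit e : LRing m n) = (monoUnit (-e) : (LRing m n)ˣ) := by
  rw [invol, monoUnit, AddMonoidAlgebra.domCongr_single]
  rfl

theorem invol_x (i : Fin m) :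
    Units.map ((invol : LRing m n ≃ₐ[ℤ] LRing m n) : LRing m n →* LRing m n) (x m n i) =
      (x m n i)⁻¹ :=
  Units.ext (invol_monoUnit _)

theorem invol_y (j : Fin n) :
    Units.map ((invol : LRing m n ≃ₐ[ℤ] LRing m n) : LRing m n →* LRing m n) (y m n j) =
      (y m n j)⁻¹ :=
  Units.ext (invol_monoUnit _)

theorem alternant_inv {R : Type*} [CommRing R] {k : ℕ} (u : Fin k → Rˣ) (α : Fin k → ℤ) :
    alternant (fun i => (u i)⁻¹) α = alternant u (-α) := by
  simp [alternant]

theorem invol_alternant_x (α : Fin m → ℤ) :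
    invol (alternant (x m n) α) = alternant (x m n) (-α) := by
  rw [← alternant_inv]
  refine (map_alternant ((invol : LRing m n ≃ₐ[ℤ] LRing m n) : LRing m n →+* LRing m n) _ _).trans ?_
  congr 1
  ext1 i
  exact invol_x i

theorem invol_alternant_y (β : Fin n → ℤ) :
    invol (alternant (y m n) β) = alternant (y m n) (-β) := by
  rw [← alternant_inv]
  refine (map_alternant ((invol : LRing m n ≃ₐ[ℤ] LRing m n) : LRing m n →+* LRing m n) _ _).trans ?_
  congr 1
  ext1 i
  exact invol_y i

variable (m n) in
/-- The product of the alternants `det (x_i^{-α_j})` and `det (y_i^{-β_j})`. -/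
def dualAlternant (α : Fin m → ℤ) (β : Fin n → ℤ) : LRing m n :=
  alternant (x m n) (-α) * alternant (y m n) (-β)

theorem permute_dualAlternant (σ : Equiv.Perm (Fin m)) (τ : Equiv.Perm (Fin n))
    (α : Fin m → ℤ) (β : Fin n → ℤ) :
    permute σ τ (dualAlternant m n α β) =
      ((Equiv.Perm.sign σ * Equiv.Perm.sign τ : ℤˣ) : ℤ) • dualAlternant m n α β := by
  have h1 := map_alternant (permute σ τ : LRing m n →+* LRing m n) (x m n) (-α)
  have h2 := map_alternant (permute σ τ : LRing m n →+* LRing m n) (y m n) (-β)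
  have h3 : (fun i => Units.map ((permute σ τ : LRing m n →+* LRing m n) : LRing m n →* LRing m n)
      (x m n i)) = x m n ∘ σ := funext fun i => permute_x σ τ i
  have h4 : (fun i => Units.map ((permute σ τ : LRing m n →+* LRing m n) : LRing m n →* LRing m n)
      (y m n i)) = y m n ∘ τ := funext fun i => permute_y σ τ i
  rw [h3, alternant_comp_perm] at h1
  rw [h4, alternant_comp_perm] at h2
  rw [dualAlternant, map_mul]
  refine (congrArg₂ (· * ·) h1 h2).trans ?_
  rw [zsmul_eq_mul, Units.val_mul, Int.cast_mul]
  ring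

theorem smul_mul_permute (σ : Equiv.Perm (Fin m)) (τ : Equiv.Perm (Fin n))
    (α : Fin m → ℤ) (β : Fin n → ℤ) (F : LRing m n) :
    ((Equiv.Perm.sign σ * Equiv.Perm.sign τ : ℤˣ) : ℤ) • (dualAlternant m n α β * permute σ τ F) =
      permute σ τ (dualAlternant m n α β * F) := by
  rw [map_mul, permute_dualAlternant, smul_mul_assoc]

theorem seriesTerm_mul_alternation (α : Fin m → ℤ) (β : Fin n → ℤ) (F : LRing m n) :
    seriesTerm (dualAlternant m n α β * alternation F) (geomProd m n Finset.univ) =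
      m.factorial * n.factorial *
        seriesTerm (dualAlternant m n α β * F) (geomProd m n Finset.univ) := by
  have h : dualAlternant m n α β * alternation F = ∑ σ : Equiv.Perm (Fin m),
      ∑ τ : Equiv.Perm (Fin n), permute σ τ (dualAlternant m n α β * F) := by
    rw [alternation, Finset.mul_sum]
    refine Finset.sum_congr rfl fun σ _ => ?_
    rw [Finset.mul_sum]
    refine Finset.sum_congr rfl fun τ _ => ?_
    rw [mul_smul_comm, smul_mul_permute]
  have h2 : ∀ (σ : Equiv.Perm (Fin m)) (τ : Equiv.Perm (Fin n)),
      seriesTerm (permute σ τ (dualAlternant m n α β * F)) (geomProd m n Finset.univ) =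
        seriesTerm (dualAlternant m n α β * F) (geomProd m n Finset.univ) := fun σ τ => by
    have := seriesTerm_permute σ τ (dualAlternant m n α β * F) Finset.univ
    rwa [Finset.map_univ_equiv] at this
  rw [h, seriesTerm_sum (geomProd_mem _)]
  simp only [seriesTerm_sum (geomProd_mem _), h2]
  simp [Fintype.card_perm, mul_assoc]

theorem invol_rhoMono_x :
    invol (rhoMono (x m n) : LRing m n) * (rhoMono (x m n) : LRing m n) = 1 := by
  have : Units.map ((invol : LRing m n ≃ₐ[ℤ] LRing m n) : LRing m n →* LRing m n)
      (rhoMono (x m n)) = (rhoMono (x m n))⁻¹ := by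
    simp only [rhoMono, map_prod, map_zpow, invol_x, inv_zpow, Finset.prod_inv_distrib]
  exact (congrArg (fun v : (LRing m n)ˣ => (v : LRing m n) * (rhoMono (x m n) : LRing m n))
    this).trans (Units.inv_mul _)

theorem invol_rhoMono_y :
    invol (rhoMono (y m n) : LRing m n) * (rhoMono (y m n) : LRing m n) = 1 := by
  have : Units.map ((invol : LRing m n ≃ₐ[ℤ] LRing m n) : LRing m n →* LRing m n)
      (rhoMono (y m n)) = (rhoMono (y m n))⁻¹ := by
    simp only [rhoMono, map_prod, map_zpow, invol_y, inv_zpow, Finset.prod_inv_distrib]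
  exact (congrArg (fun v : (LRing m n)ˣ => (v : LRing m n) * (rhoMono (y m n) : LRing m n))
    this).trans (Units.inv_mul _)

theorem invol_ratio (i : Fin m) (j : Fin n) :
    invol (ratio m n i j) = ((x m n i / y m n j : (LRing m n)ˣ) : LRing m n) := by
  refine (congrArg (fun v : (LRing m n)ˣ => (v : LRing m n)) (?_ : Units.map
    ((invol : LRing m n ≃ₐ[ℤ] LRing m n) : LRing m n →* LRing m n) (y m n j / x m n i) = _))
  rw [map_div, invol_x, invol_y, inv_div_inv]

theorem one_add_inv_ratio (i : Fin m) (j : Fin n) :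
    1 + ((x m n i / y m n j : (LRing m n)ˣ) : LRing m n) =
      ((x m n i / y m n j : (LRing m n)ˣ) : LRing m n) * (1 + ratio m n i j) := by
  rw [ratio, mul_add, mul_one, ← Units.val_mul, div_mul_div_cancel, div_self', Units.val_one,
    add_comm]

theorem invol_deltaXY_mul_prefactor :
    invol (deltaXY m n) * (prefactor m n : LRing m n) = deltaXY m n := by
  have h : (prefactor m n : LRing m n) = ∏ i, ∏ j, ratio m n i j := by
    simp only [ratio, ← Units.coe_prod, prefactor, Finset.prod_div_distrib, Finset.prod_const,
      Finset.card_univ, Fintype.card_fin, Finset.prod_pow]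
  rw [h, deltaXY, map_prod, ← Finset.prod_mul_distrib]
  refine Finset.prod_congr rfl fun i _ => ?_
  rw [map_prod, ← Finset.prod_mul_distrib]
  refine Finset.prod_congr rfl fun j _ => ?_
  change invol (1 + ratio m n i j) * _ = 1 + ratio m n i j
  rw [map_add, map_one, invol_ratio, add_mul, one_mul, ratio, ← Units.val_mul,
    div_mul_div_cancel, div_self', Units.val_one, add_comm]

theorem deltaXY_eq : deltaXY m n = ∏ q : Fin m × Fin n, (1 + ratio m n q.1 q.2) := by
  rw [Fintype.prod_prod_type]
  rfl

/-- The exponents `λ + ρ`. -/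
def addRho {k : ℕ} (lam : Fin k → ℤ) (j : Fin k) : ℤ := lam j + ((k : ℤ) - 1 - (j : ℤ))

theorem pairing_alternationQuot (lam : Fin m → ℤ) (mu : Fin n → ℤ) (F : LRing m n) :
    pairing (deltaXY m n * schur (x m n) lam * schur (y m n) mu) (alternationQuot F) =
      seriesTerm (dualAlternant m n (addRho lam) (addRho mu) * F) (geomProd m n Finset.univ) := by
  have hx : alternant (x m n) (-addRho lam) =
      invol (schur (x m n) lam) * (invol (delta (x m n)) * invol (rhoMono (x m n) : LRing m n)) := by
    rw [← invol_alternant_x, ← map_mul, vdm_eq, ← map_mul, schur_spec]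
    rfl
  have hy : alternant (y m n) (-addRho mu) =
      invol (schur (y m n) mu) * (invol (delta (y m n)) * invol (rhoMono (y m n) : LRing m n)) := by
    rw [← invol_alternant_y, ← map_mul, vdm_eq, ← map_mul, schur_spec]
    rfl
  have h : invol (deltaXY m n * schur (x m n) lam * schur (y m n) mu) * alternationQuot F *
      (delta (x m n) * invol (delta (x m n))) * (delta (y m n) * invol (delta (y m n))) *
      (prefactor m n : LRing m n) = dualAlternant m n (addRho lam) (addRho mu) * alternation F *
        ∏ q : Fin m × Fin n, (1 + ratio m n q.1 q.2) := by
    rw [← deltaXY_eq, ← alternationQuot_spec, weylDen, dualAlternant, hx, hy, map_mul, map_mul]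
    conv_rhs => rw [← invol_deltaXY_mul_prefactor]
    linear_combination (-(invol (schur (x m n) lam)) * invol (schur (y m n) mu) *
      invol (deltaXY m n) * (prefactor m n : LRing m n) * alternationQuot F *
      (delta (x m n) * invol (delta (x m n))) * (delta (y m n) * invol (delta (y m n)))) *
      (invol_rhoMono_x (m := m) (n := n) * invol (rhoMono (y m n) : LRing m n) *
        (rhoMono (y m n) : LRing m n) + invol_rhoMono_y (m := m) (n := n))
  have h2 : constTermDiv (invol (deltaXY m n * schur (x m n) lam * schur (y m n) mu) *
      alternationQuot F *
      (delta (x m n) * invol (delta (x m n))) * (delta (y m n) * invol (delta (y m n)))) =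
      m.factorial * n.factorial *
        seriesTerm (dualAlternant m n (addRho lam) (addRho mu) * F)
          (geomProd m n Finset.univ) := by
    rw [← seriesTerm_mul_alternation, ← seriesTerm_mul_prod_mul_geomProd (geomProd_mem _) _
      Finset.univ, ← pow_two, ← expansion_eq, ← h]
    rfl
  have hm : (m.factorial : ℚ) ≠ 0 := by positivity
  have hn : (n.factorial : ℚ) ≠ 0 := by positivity
  rw [pairing, h2]
  push_cast
  field_simp

/-! ### The Cauchy determinant -/

section Cauchy

variable {R : Type*} [CommRing R] {k : ℕ}

theorem alternant_rho (u : Fin k → Rˣ) :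
    alternant u (fun j => (k : ℤ) - 1 - (j : ℤ)) = vdm u := by
  have h := Matrix.det_projVandermonde (fun _ => (1 : R)) (fun i => (u i : R))
  have h2 : Matrix.projVandermonde (fun _ => (1 : R)) (fun i => (u i : R)) =
      Matrix.of fun i j : Fin k => ((u i ^ ((k : ℤ) - 1 - (j : ℤ)) : Rˣ) : R) := by
    ext i j
    have hk : (k : ℤ) - 1 - (j : ℤ) = ((j.rev : ℕ) : ℤ) := by
      rw [Fin.val_rev]
      have := j.2
      omega
    rw [Matrix.projVandermonde_apply, Matrix.of_apply, hk, zpow_natCast, Units.val_pow_eq_pow_val,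
      one_pow, one_mul]
  rw [alternant, ← h2, h, vdm]
  simp

/-- The polynomial `∏_{l ≠ j} (X + v_l)`. -/
def complProd (v : Fin k → R) (j : Fin k) : Polynomial R :=
  ∏ l ∈ Finset.univ.erase j, (Polynomial.X + Polynomial.C (v l))

theorem eval_complProd (v : Fin k → R) (j : Fin k) (a : R) :
    (complProd v j).eval a = ∏ l ∈ Finset.univ.erase j, (a + v l) := by
  simp [complProd, Polynomial.eval_prod]

theorem vandermonde_mul_coeff_complProd [Nontrivial R] (v w : Fin k → R) :
    Matrix.vandermonde w * (Matrix.of fun l j : Fin k => (complProd v j).coeff l) =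
      Matrix.of fun i j : Fin k => ∏ l ∈ Finset.univ.erase j, (w i + v l) := by
  ext i j
  have hdeg : (complProd v j).natDegree < k := by
    have h1 : (complProd v j).natDegree ≤ ∑ _l ∈ Finset.univ.erase j, 1 :=
      (Polynomial.natDegree_prod_le _ _).trans
        (Finset.sum_le_sum fun l _ => (Polynomial.natDegree_X_add_C (v l)).le)
    have := j.2
    simp at h1
    omega
  rw [Matrix.of_apply, ← eval_complProd, Polynomial.eval_eq_sum_range' hdeg, Matrix.mul_apply,
    Finset.sum_range]
  simp [Matrix.vandermonde_apply, mul_comm]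

theorem cauchy_identity [IsDomain R] {u v : Fin k → Rˣ} (hv : Function.Injective v) :
    vdm u * vdm v = ∑ σ : Equiv.Perm (Fin k), (Equiv.Perm.sign σ : ℤ) •
      ∏ i, ∏ l ∈ Finset.univ.erase i, ((u (σ i) : R) + (v l : R)) := by
  set c := (Matrix.of fun l j : Fin k => (complProd (fun i => (v i : R)) j).coeff l).det with hc
  set V := ∏ i : Fin k, ∏ j ∈ Finset.Ioi i, ((v j : R) - (v i : R)) with hV
  have hneg : Matrix.det (Matrix.vandermonde fun i => -(v i : R)) = vdm v := by
    rw [Matrix.det_vandermonde, vdm]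
    refine Finset.prod_congr rfl fun i _ => Finset.prod_congr rfl fun j _ => ?_
    ring
  have hdiag : (Matrix.of fun i j : Fin k =>
      ∏ l ∈ Finset.univ.erase j, (-(v i : R) + (v l : R))) =
      Matrix.diagonal fun j => ∏ l ∈ Finset.univ.erase j, (-(v j : R) + (v l : R)) := by
    ext i j
    rw [Matrix.of_apply, Matrix.diagonal_apply]
    split_ifs with h
    · rw [h]
    · exact Finset.prod_eq_zero (Finset.mem_erase.2 ⟨h, Finset.mem_univ i⟩) (by simp)
  have hsplit : ∏ j, ∏ l ∈ Finset.univ.erase j, (-(v j : R) + (v l : R)) = V * vdm v := by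
    have h1 : ∀ j : Fin k, ∏ l ∈ Finset.univ.erase j, (-(v j : R) + (v l : R)) =
        (∏ l ∈ Finset.Ioi j, ((v l : R) - (v j : R))) *
          ∏ l ∈ Finset.Iio j, ((v l : R) - (v j : R)) := fun j => by
      rw [← Finset.prod_union]
      · refine Finset.prod_congr ?_ fun l _ => by ring
        ext l
        simp [lt_or_lt_iff_ne, eq_comm]
      · rw [Finset.disjoint_left]
        intro l h1 h2
        exact lt_asymm (Finset.mem_Ioi.1 h1) (Finset.mem_Iio.1 h2)
    simp only [h1, Finset.prod_mul_distrib]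
    congr 1
    rw [vdm, Finset.prod_comm' (t' := Finset.univ) (s' := fun l => Finset.Ioi l)]
    intro a b
    simp
  have hvdm : vdm v ≠ 0 := by
    rw [vdm]
    refine Finset.prod_ne_zero_iff.2 fun i _ => Finset.prod_ne_zero_iff.2 fun j hj => ?_
    rw [sub_ne_zero]
    exact fun h => (Finset.mem_Ioi.1 hj).ne (hv (Units.ext h))
  have hcV : c = V := by
    have h := congrArg Matrix.det
      (vandermonde_mul_coeff_complProd (fun i => (v i : R)) (fun i => -(v i : R)))
    rw [Matrix.det_mul, hneg, hdiag, Matrix.det_diagonal, hsplit, mul_comm V] at h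
    exact mul_left_cancel₀ hvdm h
  have h := congrArg Matrix.det
    (vandermonde_mul_coeff_complProd (fun i => (v i : R)) (fun i => (u i : R)))
  rw [Matrix.det_mul, Matrix.det_vandermonde, ← hc, hcV, Matrix.det_apply] at h
  refine Eq.trans ?_ h
  rw [vdm, vdm, hV, ← Finset.prod_mul_distrib, ← Finset.prod_mul_distrib]
  refine Finset.prod_congr rfl fun i _ => ?_
  rw [← Finset.prod_mul_distrib, ← Finset.prod_mul_distrib]
  refine Finset.prod_congr rfl fun j _ => ?_
  ring

end Cauchy

/-! ### The action on the last variables -/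

section Block

variable {r s p : ℕ}

variable (r s p) in
/-- The pairs of indices of the last variables. -/
def blockEmb : Fin p × Fin p ↪ Fin (r + p) × Fin (s + p) :=
  (Fin.natAddEmb r).prodMap (Fin.natAddEmb s)

variable (r) in
/-- The extension of a permutation of the last indices. -/
def extendPerm (σ : Equiv.Perm (Fin p)) : Equiv.Perm (Fin (r + p)) :=
  σ.viaFintypeEmbedding (Fin.natAddEmb r)

theorem extendPerm_natAdd (σ : Equiv.Perm (Fin p)) (i : Fin p) :
    extendPerm r σ (Fin.natAdd r i) = Fin.natAdd r (σ i) :=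
  σ.viaFintypeEmbedding_apply_image (Fin.natAddEmb r) i

theorem extendPerm_castAdd (σ : Equiv.Perm (Fin p)) (i : Fin r) :
    extendPerm r σ (Fin.castAdd p i) = Fin.castAdd p i := by
  refine σ.viaFintypeEmbedding_apply_notMem_range (Fin.natAddEmb r) ?_
  rintro ⟨j, hj⟩
  have := congrArg Fin.val hj
  simp at this
  have := i.2
  omega

theorem sign_extendPerm (σ : Equiv.Perm (Fin p)) :
    Equiv.Perm.sign (extendPerm r σ) = Equiv.Perm.sign σ :=
  σ.viaFintypeEmbedding_sign (Fin.natAddEmb r)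

variable (r s p) in
/-- The last variables among the `x_i`. -/
def lastX (i : Fin p) : (LRing (r + p) (s + p))ˣ := x (r + p) (s + p) (Fin.natAdd r i)

variable (r s p) in
/-- The last variables among the `y_j`. -/
def lastY (i : Fin p) : (LRing (r + p) (s + p))ˣ := y (r + p) (s + p) (Fin.natAdd s i)

theorem lastY_injective : Function.Injective (lastY r s p) := by
  intro i j h
  have h1 := congrArg (fun v : (LRing (r + p) (s + p))ˣ =>
    (v : LRing (r + p) (s + p)).coeff (0, Pi.single (Fin.natAdd s i) 1)) h
  simp only [lastY, y, monoUnit, AddMonoidAlgebra.coeff_single, Finsupp.single_eq_same] at h1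
  by_contra hij
  rw [Finsupp.single_eq_of_ne] at h1
  · exact one_ne_zero h1
  · intro h2
    have := congrFun (congrArg Prod.snd h2) (Fin.natAdd s i)
    simp [hij] at this

/-- The action of a pair of permutations on the last variables. -/
def permuteLast (σ τ : Equiv.Perm (Fin p)) :
    LRing (r + p) (s + p) ≃ₐ[ℤ] LRing (r + p) (s + p) :=
  permute (extendPerm r σ) (extendPerm s τ)

theorem permuteLast_lastX (σ τ : Equiv.Perm (Fin p)) (i : Fin p) :
    Units.map ((permuteLast σ τ : LRing (r + p) (s + p) ≃ₐ[ℤ] LRing (r + p) (s + p)) : LRing (r + p) (s + p) →* LRing (r + p) (s + p))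
      (lastX r s p i) = lastX r s p (σ i) := by
  rw [permuteLast, lastX, permute_x, extendPerm_natAdd, lastX]

theorem permuteLast_lastY (σ τ : Equiv.Perm (Fin p)) (i : Fin p) :
    Units.map ((permuteLast σ τ : LRing (r + p) (s + p) ≃ₐ[ℤ] LRing (r + p) (s + p)) : LRing (r + p) (s + p) →* LRing (r + p) (s + p))
      (lastY r s p i) = lastY r s p (τ i) := by
  rw [permuteLast, lastY, permute_y, extendPerm_natAdd, lastY]

theorem seriesTerm_permuteLast (σ τ : Equiv.Perm (Fin p)) (F : LRing (r + p) (s + p))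
    (Q : Finset (Fin p × Fin p)) :
    seriesTerm (permuteLast σ τ F)
        (geomProd _ _ ((Q.map (σ.prodCongr τ).toEmbedding).map (blockEmb r s p))) =
      seriesTerm F (geomProd _ _ (Q.map (blockEmb r s p))) := by
  rw [← seriesTerm_permute (extendPerm r σ) (extendPerm s τ) F, Finset.map_map, Finset.map_map]
  congr 3
  ext1 q
  exact Prod.ext (extendPerm_natAdd σ q.1).symm (extendPerm_natAdd τ q.2).symm

/-- The elements on which the permutations of the last variables act by the sign. -/
def IsAntisymmetric (W : LRing (r + p) (s + p)) : Prop :=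
  ∀ σ τ : Equiv.Perm (Fin p), permuteLast σ τ W =
    ((Equiv.Perm.sign σ * Equiv.Perm.sign τ : ℤˣ) : ℤ) • W

/-- The product of the Vandermonde products of the last variables as an alternating sum. -/
theorem sum_permuteLast_rho :
    ∑ σ : Equiv.Perm (Fin p), ∑ τ : Equiv.Perm (Fin p),
      ((Equiv.Perm.sign σ * Equiv.Perm.sign τ : ℤˣ) : ℤ) •
        permuteLast σ τ ((rhoMono (lastX r s p) * rhoMono (lastY r s p) :
          (LRing (r + p) (s + p))ˣ) : LRing (r + p) (s + p)) =
      vdm (lastX r s p) * vdm (lastY r s p) := by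
  rw [← alternant_rho, ← alternant_rho, alternant, alternant, Matrix.det_apply',
    Matrix.det_apply', Finset.sum_mul_sum]
  refine Finset.sum_congr rfl fun σ _ => Finset.sum_congr rfl fun τ _ => ?_
  have h : permuteLast σ τ ((rhoMono (lastX r s p) * rhoMono (lastY r s p) :
          (LRing (r + p) (s + p))ˣ) : LRing (r + p) (s + p)) =
      (((∏ i, lastX r s p (σ i) ^ ((p : ℤ) - 1 - (i : ℤ))) *
        ∏ i, lastY r s p (τ i) ^ ((p : ℤ) - 1 - (i : ℤ)) :
          (LRing (r + p) (s + p))ˣ) : LRing (r + p) (s + p)) := by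
    refine congrArg Units.val (?_ : Units.map
      ((permuteLast σ τ : LRing (r + p) (s + p) ≃ₐ[ℤ] LRing (r + p) (s + p)) :
      LRing (r + p) (s + p) →* LRing (r + p) (s + p)) _ = _)
    simp only [rhoMono, map_mul, map_prod, map_zpow, permuteLast_lastX, permuteLast_lastY]
  rw [h]
  simp only [Matrix.of_apply, Units.val_mul, Units.coe_prod, zsmul_eq_mul, Int.cast_mul]
  ring

theorem factorial_sq_mul_seriesTerm {W : LRing (r + p) (s + p)} (hW : IsAntisymmetric W) :
    (p.factorial * p.factorial : ℤ) *
      seriesTerm (W * ((rhoMono (lastX r s p) * rhoMono (lastY r s p) :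
          (LRing (r + p) (s + p))ˣ) : LRing (r + p) (s + p)))
        (geomProd _ _ (Finset.univ.map (blockEmb r s p))) =
      seriesTerm (W * (vdm (lastX r s p) * vdm (lastY r s p)))
        (geomProd _ _ (Finset.univ.map (blockEmb r s p))) := by
  set ρ := ((rhoMono (lastX r s p) * rhoMono (lastY r s p) :
          (LRing (r + p) (s + p))ˣ) : LRing (r + p) (s + p)) with hρ
  have h : W * (vdm (lastX r s p) * vdm (lastY r s p)) = ∑ σ : Equiv.Perm (Fin p),
      ∑ τ : Equiv.Perm (Fin p), permuteLast σ τ (W * ρ) := by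
    rw [← sum_permuteLast_rho, Finset.mul_sum]
    refine Finset.sum_congr rfl fun σ _ => ?_
    rw [Finset.mul_sum]
    refine Finset.sum_congr rfl fun τ _ => ?_
    rw [map_mul, hW, mul_smul_comm, smul_mul_assoc]
  have h2 : ∀ (σ τ : Equiv.Perm (Fin p)),
      seriesTerm (permuteLast σ τ (W * ρ)) (geomProd _ _ (Finset.univ.map (blockEmb r s p))) =
        seriesTerm (W * ρ) (geomProd _ _ (Finset.univ.map (blockEmb r s p))) := fun σ τ => by
    have := seriesTerm_permuteLast σ τ (W * ρ) Finset.univ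
    rwa [Finset.map_univ_equiv] at this
  rw [h, seriesTerm_sum (geomProd_mem _)]
  simp only [seriesTerm_sum (geomProd_mem _), h2]
  simp [Fintype.card_perm, mul_assoc]

variable (p) in
/-- The diagonal of a square. -/
def diagPairs : Finset (Fin p × Fin p) :=
  Finset.univ.map ⟨fun i => (i, i), fun _ _ h => congrArg Prod.fst h⟩

theorem mem_map_diagPairs (σ : Equiv.Perm (Fin p)) (q : Fin p × Fin p) :
    q ∈ (diagPairs p).map (σ.prodCongr (1 : Equiv.Perm (Fin p))).toEmbedding ↔ q.1 = σ q.2 := by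
  obtain ⟨a, b⟩ := q
  simp only [diagPairs, Finset.mem_map, Finset.mem_univ, true_and,
    Function.Embedding.coeFn_mk]
  constructor
  · rintro ⟨_, ⟨i, rfl⟩, hi⟩
    have h1 : σ i = a := congrArg Prod.fst hi
    have h2 : i = b := congrArg Prod.snd hi
    rw [← h1, h2]
  · rintro rfl
    exact ⟨_, ⟨b, rfl⟩, rfl⟩

theorem lastX_add_lastY (i l : Fin p) :
    (lastX r s p i : LRing (r + p) (s + p)) + (lastY r s p l : LRing (r + p) (s + p)) =
      (lastX r s p i : LRing (r + p) (s + p)) *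
        (1 + ratio _ _ (Fin.natAdd r i) (Fin.natAdd s l)) := by
  rw [ratio, mul_add, mul_one, ← Units.val_mul]
  change _ = _ + (((lastX r s p i) * (lastY r s p l / lastX r s p i) :
    (LRing (r + p) (s + p))ˣ) : LRing (r + p) (s + p))
  rw [mul_div_cancel]

theorem prod_lastX_add_lastY (σ : Equiv.Perm (Fin p)) :
    ∏ i, ∏ l ∈ Finset.univ.erase i, ((lastX r s p (σ i) : LRing (r + p) (s + p)) +
        (lastY r s p l : LRing (r + p) (s + p))) =
      (((∏ i, lastX r s p i) ^ (p - 1) : (LRing (r + p) (s + p))ˣ) : LRing (r + p) (s + p)) *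
        ∏ q ∈ (Finset.univ \ (diagPairs p).map
          (σ.prodCongr (1 : Equiv.Perm (Fin p))).toEmbedding).map (blockEmb r s p),
          (1 + ratio _ _ q.1 q.2) := by
  simp only [lastX_add_lastY, Finset.prod_mul_distrib, Finset.prod_const]
  have h1 : ∏ i, (lastX r s p (σ i) : LRing (r + p) (s + p)) ^ (Finset.univ.erase i).card =
      (((∏ i, lastX r s p i) ^ (p - 1) : (LRing (r + p) (s + p))ˣ) : LRing (r + p) (s + p)) := by
    simp only [Finset.card_erase_of_mem (Finset.mem_univ _), Finset.card_univ, Fintype.card_fin,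
      Finset.prod_pow, Units.val_pow_eq_pow_val, Units.coe_prod]
    rw [Equiv.prod_comp σ fun i => (lastX r s p i : LRing (r + p) (s + p))]
  rw [h1]
  congr 1
  rw [Finset.prod_map, Finset.prod_sigma']
  refine Finset.prod_bij' (fun a _ => (σ a.1, a.2)) (fun q _ => ⟨σ⁻¹ q.1, q.2⟩) ?_ ?_ ?_ ?_ ?_
  · rintro ⟨i, l⟩ h
    simp only [Finset.mem_sigma, Finset.mem_univ, Finset.mem_erase, true_and, and_true] at h
    rw [Finset.mem_sdiff, mem_map_diagPairs]
    simpa [eq_comm] using h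
  · rintro ⟨a, b⟩ h
    rw [Finset.mem_sdiff, mem_map_diagPairs] at h
    simp only [Finset.mem_sigma, Finset.mem_univ, Finset.mem_erase, true_and, and_true]
    rintro rfl
    simp at h
  · simp
  · simp
  · intro a _
    rfl

theorem permuteLast_prod_lastX (σ τ : Equiv.Perm (Fin p)) (k : ℕ) :
    permuteLast σ τ (((∏ i, lastX r s p i) ^ k : (LRing (r + p) (s + p))ˣ) :
        LRing (r + p) (s + p)) =
      (((∏ i, lastX r s p i) ^ k : (LRing (r + p) (s + p))ˣ) : LRing (r + p) (s + p)) := by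
  refine congrArg Units.val (?_ : Units.map
      ((permuteLast σ τ : LRing (r + p) (s + p) ≃ₐ[ℤ] LRing (r + p) (s + p)) :
      LRing (r + p) (s + p) →* LRing (r + p) (s + p)) _ = _)
  simp only [map_pow, map_prod, permuteLast_lastX]
  rw [Equiv.prod_comp σ fun i => lastX r s p i]

/-- The Cauchy determinant, under the constant term. -/
theorem factorial_mul_seriesTerm {W : LRing (r + p) (s + p)} (hW : IsAntisymmetric W) :
    (p.factorial : ℤ) *
      seriesTerm (W * ((rhoMono (lastX r s p) * rhoMono (lastY r s p) :
          (LRing (r + p) (s + p))ˣ) : LRing (r + p) (s + p)))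
        (geomProd _ _ (Finset.univ.map (blockEmb r s p))) =
      seriesTerm (W * (((∏ i, lastX r s p i) ^ (p - 1) : (LRing (r + p) (s + p))ˣ) :
          LRing (r + p) (s + p)))
        (geomProd _ _ ((diagPairs p).map (blockEmb r s p))) := by
  have hp : (p.factorial : ℤ) ≠ 0 := by positivity
  refine mul_left_cancel₀ hp ?_
  rw [← mul_assoc, factorial_sq_mul_seriesTerm hW, cauchy_identity lastY_injective,
    Finset.mul_sum, seriesTerm_sum (geomProd_mem _)]
  have key : ∀ σ : Equiv.Perm (Fin p),
      seriesTerm (W * (Equiv.Perm.sign σ : ℤ) • ∏ i, ∏ l ∈ Finset.univ.erase i,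
        ((lastX r s p (σ i) : LRing (r + p) (s + p)) +
          (lastY r s p l : LRing (r + p) (s + p))))
        (geomProd _ _ (Finset.univ.map (blockEmb r s p))) =
      seriesTerm (W * (((∏ i, lastX r s p i) ^ (p - 1) : (LRing (r + p) (s + p))ˣ) :
          LRing (r + p) (s + p)))
        (geomProd _ _ ((diagPairs p).map (blockEmb r s p))) := fun σ => by
    rw [prod_lastX_add_lastY, mul_smul_comm, ← mul_assoc, ← smul_mul_assoc, seriesTerm_mul_prod _
      (Finset.map_subset_map.2 (Finset.subset_univ _)), ← Finset.map_sdiff,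
      Finset.sdiff_sdiff_eq_self (Finset.subset_univ _), ← seriesTerm_permuteLast σ 1
      (W * _), map_mul, permuteLast_prod_lastX, hW, Equiv.Perm.sign_one, mul_one, smul_mul_assoc]
  rw [Finset.sum_congr rfl fun σ _ => key σ]
  simp [Fintype.card_perm]

end Block

/-! ### Evaluation on monomials -/

section Diagonal

variable {r s p : ℕ}

variable (r s) in
/-- The exponent of `∏ (v_i / u_i)^{k_i}` in the last variables `u`, `v`. -/
def ratioExpo (k : Fin p → ℕ) : Expo (r + p) (s + p) :=
  (Fin.append 0 fun i => -(k i : ℤ), Fin.append 0 fun i => (k i : ℤ))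

theorem prod_neg_ratio_pow (k : Fin p → ℕ) :
    ∏ i, (-ratio (r + p) (s + p) (Fin.natAdd r i) (Fin.natAdd s i)) ^ k i =
      (-1) ^ (∑ i, k i) * (monoUnit (ratioExpo r s k) : LRing (r + p) (s + p)) := by
  have h : (monoUnit (ratioExpo r s k) : (LRing (r + p) (s + p))ˣ) =
      ∏ i, (y (r + p) (s + p) (Fin.natAdd s i) / x (r + p) (s + p) (Fin.natAdd r i)) ^ k i := by
    rw [monoUnit_eq, Fin.prod_univ_add, Fin.prod_univ_add, ratioExpo]
    simp only [Fin.append_left, Fin.append_right, Pi.zero_apply, zpow_zero, Finset.prod_const_one,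
      one_mul, ← Finset.prod_mul_distrib]
    refine Finset.prod_congr rfl fun i _ => ?_
    rw [zpow_neg, zpow_natCast, zpow_natCast, div_pow, mul_comm, div_eq_mul_inv]
  rw [h, Units.coe_prod, ← Finset.prod_pow_eq_pow_sum, ← Finset.prod_mul_distrib]
  refine Finset.prod_congr rfl fun i _ => ?_
  rw [neg_pow, ratio, Units.val_pow_eq_pow_val]

variable (r s p) in
/-- The product of the series `(1 + t v_i / u_i)⁻¹` in the last variables `u`, `v`. -/
def diagSeries : PowerSeries (LRing (r + p) (s + p)) :=
  geomProd _ _ ((diagPairs p).map (blockEmb r s p))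

theorem coeff_diagSeries (d : ℕ) :
    PowerSeries.coeff d (diagSeries r s p) =
      ∑ k ∈ Finset.finsuppAntidiag (Finset.univ : Finset (Fin p)) d,
        (-1) ^ d * (monoUnit (ratioExpo r s k) : LRing (r + p) (s + p)) := by
  rw [diagSeries, geomProd, Finset.prod_map, diagPairs, Finset.prod_map, PowerSeries.coeff_prod]
  refine Finset.sum_congr rfl fun k hk => ?_
  rw [← (Finset.mem_finsuppAntidiag.1 hk).1, ← prod_neg_ratio_pow]
  refine Finset.prod_congr rfl fun i _ => ?_
  rw [geomSeries, PowerSeries.coeff_mk]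
  rfl

theorem constTerm_monoUnit_mul (e e' : Expo (r + p) (s + p)) (d : ℕ) :
    constTerm ((monoUnit e : LRing (r + p) (s + p)) * ((-1) ^ d *
      (monoUnit e' : LRing (r + p) (s + p)))) = if e' = -e then (-1) ^ d else 0 := by
  classical
  have h : ((-1) ^ d * (monoUnit e' : LRing (r + p) (s + p))) =
      ((-1 : ℤ) ^ d) • (monoUnit e' : LRing (r + p) (s + p)) := by
    rw [zsmul_eq_mul]
    push_cast
    rfl
  rw [h]
  refine (constTerm_single_mul e 1 _).trans ?_
  rw [one_mul, AddMonoidAlgebra.coeff_smul_apply, monoUnit, AddMonoidAlgebra.coeff_single,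
    Finsupp.single_apply, smul_eq_mul, mul_ite, mul_one, mul_zero]

theorem constTerm_sum {m n : ℕ} {ι : Type*} (t : Finset ι) (F : ι → LRing m n) :
    constTerm (∑ i ∈ t, F i) = ∑ i ∈ t, constTerm (F i) :=
  map_sum (⟨⟨constTerm, constTerm_zero⟩, constTerm_add⟩ : LRing m n →+ ℤ) F t

theorem seriesTerm_monoUnit_diagSeries (e : Expo (r + p) (s + p)) :
    seriesTerm (monoUnit e : LRing (r + p) (s + p)) (diagSeries r s p) =
      ∑ᶠ d : ℕ, ∑ k ∈ Finset.finsuppAntidiag (Finset.univ : Finset (Fin p)) d,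
        if ratioExpo r s k = -e then (-1) ^ d else 0 := by
  refine finsum_congr fun d => ?_
  rw [coeff_diagSeries, Finset.mul_sum, constTerm_sum]
  exact Finset.sum_congr rfl fun k _ => constTerm_monoUnit_mul _ _ _

theorem ratioExpo_injective : Function.Injective (ratioExpo r s : (Fin p → ℕ) → _) := by
  intro k k' h
  ext i
  have := congrFun (congrArg Prod.snd h) (Fin.natAdd s i)
  simpa [ratioExpo] using this

theorem seriesTerm_monoUnit_eq {e : Expo (r + p) (s + p)} {k : Fin p → ℕ}
    (h : ratioExpo r s k = -e) :
    seriesTerm (monoUnit e : LRing (r + p) (s + p)) (diagSeries r s p) = (-1) ^ ∑ i, k i := by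
  have hk : ∀ k' : Fin p →₀ ℕ, ratioExpo r s k' = -e ↔ k' = Finsupp.equivFunOnFinite.symm k := by
    intro k'
    rw [← h, ratioExpo_injective.eq_iff, Equiv.eq_symm_apply]
    rfl
  rw [seriesTerm_monoUnit_diagSeries, finsum_eq_single _ (∑ i, k i)]
  · simp only [hk]
    rw [Finset.sum_ite_eq', if_pos]
    simp [Finset.mem_finsuppAntidiag]
  · intro d hd
    refine Finset.sum_eq_zero fun k' hk' => if_neg fun h' => hd ?_
    rw [hk] at h'
    rw [← (Finset.mem_finsuppAntidiag.1 hk').1, h']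
    rfl

theorem seriesTerm_monoUnit_eq_zero {e : Expo (r + p) (s + p)}
    (h : ∀ k : Fin p → ℕ, ratioExpo r s k ≠ -e) :
    seriesTerm (monoUnit e : LRing (r + p) (s + p)) (diagSeries r s p) = 0 := by
  rw [seriesTerm_monoUnit_diagSeries]
  simp [h]

theorem dualAlternant_mul_monoUnit {m n : ℕ} (α : Fin m → ℤ) (β : Fin n → ℤ) (e : Expo m n) :
    dualAlternant m n α β * (monoUnit e : LRing m n) =
      ∑ σ : Equiv.Perm (Fin m), ∑ τ : Equiv.Perm (Fin n),
        ((Equiv.Perm.sign σ * Equiv.Perm.sign τ : ℤˣ) : ℤ) •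
          (monoUnit (e.1 - α ∘ σ, e.2 - β ∘ τ) : LRing m n) := by
  rw [dualAlternant, alternant, alternant, ← Matrix.det_transpose, ← Matrix.det_transpose
    (Matrix.of fun i j => ((y m n i ^ _ : (LRing m n)ˣ) : LRing m n)), Matrix.det_apply',
    Matrix.det_apply', Finset.sum_mul_sum, Finset.sum_mul]
  refine Finset.sum_congr rfl fun σ _ => ?_
  rw [Finset.sum_mul]
  refine Finset.sum_congr rfl fun τ _ => ?_
  have h : monoUnit (e.1 - α ∘ σ, e.2 - β ∘ τ) =
      (∏ i, x m n i ^ (-α) (σ i)) * (∏ j, y m n j ^ (-β) (τ j)) * monoUnit e := by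
    rw [monoUnit_eq, monoUnit_eq e]
    simp only [Pi.sub_apply, Pi.neg_apply, Function.comp_apply, zpow_sub, zpow_neg,
      Finset.prod_mul_distrib, Finset.prod_inv_distrib]
    exact Units.ext (by push_cast; ring)
  rw [h]
  simp only [Matrix.transpose_apply, Matrix.of_apply, Units.val_mul, Units.coe_prod, zsmul_eq_mul,
    Int.cast_mul]
  ring

theorem diagSeries_mem : diagSeries r s p ∈ homogeneousSeries (r + p) (s + p) := geomProd_mem _

theorem seriesTerm_dualAlternant_mul_monoUnit (α : Fin (r + p) → ℤ) (β : Fin (s + p) → ℤ)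
    (e : Expo (r + p) (s + p)) :
    seriesTerm (dualAlternant _ _ α β * (monoUnit e : LRing (r + p) (s + p)))
        (diagSeries r s p) =
      ∑ σ : Equiv.Perm (Fin (r + p)), ∑ τ : Equiv.Perm (Fin (s + p)),
        ((Equiv.Perm.sign σ * Equiv.Perm.sign τ : ℤˣ) : ℤ) *
          seriesTerm (monoUnit (e.1 - α ∘ σ, e.2 - β ∘ τ) : LRing (r + p) (s + p))
            (diagSeries r s p) := by
  rw [dualAlternant_mul_monoUnit]
  simp only [seriesTerm_sum diagSeries_mem, seriesTerm_zsmul diagSeries_mem]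

end Diagonal

/-! ### The form as the constant term of a product of alternants -/

section Reduction

variable {r s p : ℕ}

theorem mem_block (q : Fin (r + p) × Fin (s + p)) :
    q ∈ Finset.univ.map (blockEmb r s p) ↔ r ≤ (q.1 : ℕ) ∧ s ≤ (q.2 : ℕ) := by
  obtain ⟨i, j⟩ := q
  simp only [Finset.mem_map, Finset.mem_univ, true_and]
  constructor
  · rintro ⟨⟨a, b⟩, h⟩
    have h1 : Fin.natAdd r a = i := congrArg Prod.fst h
    have h2 : Fin.natAdd s b = j := congrArg Prod.snd h
    simp [← h1, ← h2]
  · rintro ⟨h1, h2⟩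
    refine ⟨(Fin.subNat r (i.cast (add_comm r p)) h1, Fin.subNat s (j.cast (add_comm s p)) h2), ?_⟩
    refine Prod.ext (Fin.ext ?_) (Fin.ext ?_)
    · change r + ((i : ℕ) - r) = i
      omega
    · change s + ((j : ℕ) - s) = j
      omega

variable (p) in
/-- The exponent with entries `a`, followed by `c` at the last `x_i`, and `b`, followed by `0`. -/
def blockExpo (a : Fin r → ℤ) (b : Fin s → ℤ) (c : ℤ) : Expo (r + p) (s + p) :=
  (Fin.append a fun _ => c, Fin.append b 0)

theorem eulerFactor_eq :
    eulerFactor (r + p) (s + p) r s =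
      (monoUnit (blockExpo p (0 : Fin r → ℤ) (fun _ : Fin s => -(p : ℤ)) s) :
        LRing (r + p) (s + p)) *
      ∏ q ∈ Finset.univ \ Finset.univ.map (blockEmb r s p), (1 + ratio _ _ q.1 q.2) := by
  have h1 : ∏ q ∈ Finset.univ \ Finset.univ.map (blockEmb r s p),
      (1 + ratio (r + p) (s + p) q.1 q.2) =
      ∏ i : Fin (r + p), ∏ j : Fin (s + p), if r ≤ (i : ℕ) ∧ s ≤ (j : ℕ) then 1 else 1 + ratio (r + p) (s + p) i j := by
    rw [← Fintype.prod_prod_type' fun (i : Fin (r + p)) (j : Fin (s + p)) =>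
      if r ≤ (i : ℕ) ∧ s ≤ (j : ℕ) then 1 else 1 + ratio (r + p) (s + p) i j]
    refine Finset.prod_subset_one_on_sdiff (Finset.subset_univ _) (fun q hq => ?_) fun q hq => ?_
    · rw [Finset.sdiff_sdiff_eq_self (Finset.subset_univ _), mem_block] at hq
      exact if_pos hq
    · rw [Finset.mem_sdiff, mem_block] at hq
      exact (if_neg hq.2).symm
  have h2 : (monoUnit (blockExpo p (0 : Fin r → ℤ) (fun _ : Fin s => -(p : ℤ)) s) :
      (LRing (r + p) (s + p))ˣ) =
      ∏ i : Fin (r + p), ∏ j : Fin (s + p), if r ≤ (i : ℕ) ∧ (j : ℕ) < s then x (r + p) (s + p) i / y (r + p) (s + p) j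
        else 1 := by
    rw [monoUnit_eq, Fin.prod_univ_add, Fin.prod_univ_add, Fin.prod_univ_add, blockExpo]
    have hlt : ∀ i : Fin r, ¬ r ≤ (i : ℕ) := fun i => not_le.2 i.2
    simp [Fin.prod_univ_add, Finset.prod_pow, div_eq_mul_inv, hlt, Finset.prod_mul_distrib]
  rw [h1, h2, eulerFactor, ← Finset.prod_mul_distrib, Units.coe_prod, ← Finset.prod_mul_distrib]
  refine Finset.prod_congr rfl fun i _ => ?_
  rw [← Finset.prod_mul_distrib, Units.coe_prod, ← Finset.prod_mul_distrib]
  refine Finset.prod_congr rfl fun j _ => ?_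
  by_cases hi : (i : ℕ) < r
  · simp [hi, not_le.2 hi, ratio]
  · by_cases hj : (j : ℕ) < s
    · simp only [hi, hj, not_lt.1 hi, if_true, if_false, and_self, one_mul, not_le.2 hj, and_false]
      exact one_add_inv_ratio i j
    · simp [hi, hj, not_lt.1 hi, not_lt.1 hj]

theorem rhoMono_x_add :
    rhoMono (x (r + p) (s + p)) =
      (∏ i : Fin r, x (r + p) (s + p) (Fin.castAdd p i) ^ (((r + p : ℕ) : ℤ) - 1 - (i : ℤ))) *
        rhoMono (lastX r s p) := by
  rw [rhoMono, Fin.prod_univ_add]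
  congr 1
  refine Finset.prod_congr rfl fun i _ => ?_
  rw [lastX]
  congr 1
  rw [Fin.val_natAdd]
  push_cast
  ring

theorem rhoMono_y_add :
    rhoMono (y (r + p) (s + p)) =
      (∏ i : Fin s, y (r + p) (s + p) (Fin.castAdd p i) ^ (((s + p : ℕ) : ℤ) - 1 - (i : ℤ))) *
        rhoMono (lastY r s p) := by
  rw [rhoMono, Fin.prod_univ_add]
  congr 1
  refine Finset.prod_congr rfl fun i _ => ?_
  rw [lastY]
  congr 1
  rw [Fin.val_natAdd]
  push_cast
  ring

theorem monoUnit_blockExpo (a : Fin r → ℤ) (b : Fin s → ℤ) (c : ℤ) :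
    (monoUnit (blockExpo p a b c) : (LRing (r + p) (s + p))ˣ) =
      (∏ i, x (r + p) (s + p) (Fin.castAdd p i) ^ a i) *
        (∏ i, y (r + p) (s + p) (Fin.castAdd p i) ^ b i) * (∏ i, lastX r s p i) ^ c := by
  rw [monoUnit_eq, Fin.prod_univ_add, Fin.prod_univ_add, blockExpo]
  simp only [Fin.append_left, Fin.append_right, Pi.zero_apply, zpow_zero, Finset.prod_const_one,
    mul_one, Finset.prod_zpow, lastX]
  exact mul_right_comm _ _ _

theorem permuteLast_monoUnit_blockExpo (σ τ : Equiv.Perm (Fin p)) (a : Fin r → ℤ)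
    (b : Fin s → ℤ) (c : ℤ) :
    permuteLast σ τ (monoUnit (blockExpo p a b c) : LRing (r + p) (s + p)) =
      (monoUnit (blockExpo p a b c) : LRing (r + p) (s + p)) := by
  rw [permuteLast, permute_monoUnit, monoUnit_eq]
  congr 2
  · rw [Fin.prod_univ_add, Fin.prod_univ_add]
    simp only [extendPerm_castAdd, extendPerm_natAdd, blockExpo, Fin.append_left, Fin.append_right]
    rw [Equiv.prod_comp σ fun i => x (r + p) (s + p) (Fin.natAdd r i) ^ c]
  · rw [Fin.prod_univ_add, Fin.prod_univ_add]
    simp [extendPerm_castAdd, extendPerm_natAdd, blockExpo]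

theorem isAntisymmetric_dualAlternant_mul (α : Fin (r + p) → ℤ) (β : Fin (s + p) → ℤ)
    (a : Fin r → ℤ) (b : Fin s → ℤ) (c : ℤ) :
    IsAntisymmetric (dualAlternant _ _ α β *
      (monoUnit (blockExpo p a b c) : LRing (r + p) (s + p))) := by
  intro σ τ
  rw [map_mul, permuteLast_monoUnit_blockExpo, permuteLast, permute_dualAlternant,
    sign_extendPerm, sign_extendPerm, smul_mul_assoc]

theorem factorial_mul_pairing (hr : r ≤ r + p) (hs : s ≤ s + p) (f : Diagram (r + p) (s + p))
    (g : Diagram r s) :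
    (p.factorial : ℚ) * pairing (chK f) (chE (r + p) (s + p) hr hs g) =
      (seriesTerm (dualAlternant _ _ (addRho f.lam) (addRho f.mu) *
        (monoUnit (blockExpo p (fun i => g.lam i + ((r : ℤ) + p - 1 - i))
          (fun j => g.mu j + ((s : ℤ) - 1 - j)) ((s : ℤ) + p - 1)) : LRing (r + p) (s + p)))
        (diagSeries r s p) : ℤ) := by
  rw [chK, chE, pairing_alternationQuot]
  have hF : eulerFactor (r + p) (s + p) r s *
      ((∏ i : Fin r, x (r + p) (s + p) (Fin.castLE hr i) ^ g.lam i : (LRing (r + p) (s + p))ˣ) :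
        LRing (r + p) (s + p)) *
      ((∏ j : Fin s, y (r + p) (s + p) (Fin.castLE hs j) ^ g.mu j : (LRing (r + p) (s + p))ˣ) :
        LRing (r + p) (s + p)) *
      (rhoMono (x (r + p) (s + p)) : LRing (r + p) (s + p)) *
      (rhoMono (y (r + p) (s + p)) : LRing (r + p) (s + p)) =
      (monoUnit (blockExpo p (fun i => g.lam i + ((r : ℤ) + p - 1 - i))
          (fun j => g.mu j + ((s : ℤ) - 1 - j)) s) : LRing (r + p) (s + p)) *
        ((rhoMono (lastX r s p) * rhoMono (lastY r s p) : (LRing (r + p) (s + p))ˣ) :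
          LRing (r + p) (s + p)) *
        ∏ q ∈ Finset.univ \ Finset.univ.map (blockEmb r s p), (1 + ratio _ _ q.1 q.2) := by
    rw [eulerFactor_eq]
    have : monoUnit (blockExpo p (fun i => g.lam i + ((r : ℤ) + p - 1 - i))
          (fun j => g.mu j + ((s : ℤ) - 1 - j)) s) *
          (rhoMono (lastX r s p) * rhoMono (lastY r s p)) =
        monoUnit (blockExpo p 0 (fun _ => -(p : ℤ)) s) *
        (∏ i : Fin r, x (r + p) (s + p) (Fin.castLE hr i) ^ g.lam i) *
        (∏ j : Fin s, y (r + p) (s + p) (Fin.castLE hs j) ^ g.mu j) *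
        rhoMono (x (r + p) (s + p)) * rhoMono (y (r + p) (s + p)) := by
      rw [rhoMono_x_add, rhoMono_y_add, monoUnit_blockExpo, monoUnit_blockExpo]
      have hx : ∏ i : Fin r, x (r + p) (s + p) (Fin.castAdd p i) ^
          (g.lam i + ((r : ℤ) + p - 1 - i)) =
          (∏ i : Fin r, x (r + p) (s + p) (Fin.castLE hr i) ^ g.lam i) *
          ∏ i : Fin r, x (r + p) (s + p) (Fin.castAdd p i) ^
            (((r + p : ℕ) : ℤ) - 1 - (i : ℤ)) := by
        rw [← Finset.prod_mul_distrib]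
        refine Finset.prod_congr rfl fun i _ => ?_
        rw [zpow_add]
        push_cast
        rfl
      have hy : ∏ i : Fin s, y (r + p) (s + p) (Fin.castAdd p i) ^
          (g.mu i + ((s : ℤ) - 1 - i)) =
          (∏ i : Fin s, y (r + p) (s + p) (Fin.castAdd p i) ^ (-(p : ℤ))) *
          ((∏ i : Fin s, y (r + p) (s + p) (Fin.castLE hs i) ^ g.mu i) *
          ∏ i : Fin s, y (r + p) (s + p) (Fin.castAdd p i) ^
            (((s + p : ℕ) : ℤ) - 1 - (i : ℤ))) := by
        rw [← Finset.prod_mul_distrib, ← Finset.prod_mul_distrib]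
        refine Finset.prod_congr rfl fun i _ => ?_
        change _ = _ * (y (r + p) (s + p) (Fin.castAdd p i) ^ _ * _)
        rw [← zpow_add, ← zpow_add]
        congr 1
        push_cast
        ring
      rw [hx, hy]
      simp only [Pi.zero_apply, zpow_zero, Finset.prod_const_one, one_mul]
      exact Units.ext (by simp only [Units.val_mul]; ring)
    rw [← Units.val_mul, this, Units.val_mul, Units.val_mul, Units.val_mul, Units.val_mul,
      blockExpo]
    change _ * _ * _ * _ * _ * _ = _
    simp only [Pi.zero_def]
    ring
  rw [hF, ← mul_assoc, seriesTerm_mul_prod _ (Finset.sdiff_subset),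
    Finset.sdiff_sdiff_eq_self (Finset.subset_univ _), ← mul_assoc]
  have h := factorial_mul_seriesTerm (isAntisymmetric_dualAlternant_mul (addRho f.lam)
    (addRho f.mu) (fun i => g.lam i + ((r : ℤ) + p - 1 - i))
    (fun j => g.mu j + ((s : ℤ) - 1 - j)) s)
  have hlast : monoUnit (blockExpo p (fun i => g.lam i + ((r : ℤ) + p - 1 - i))
      (fun j => g.mu j + ((s : ℤ) - 1 - j)) s) * (∏ i, lastX r s p i) ^ (p - 1) =
      monoUnit (blockExpo p (fun i => g.lam i + ((r : ℤ) + p - 1 - i))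
        (fun j => g.mu j + ((s : ℤ) - 1 - j)) ((s : ℤ) + p - 1)) := by
    rw [monoUnit_blockExpo, monoUnit_blockExpo, mul_assoc]
    congr 1
    rcases Nat.eq_zero_or_pos p with rfl | hp
    · simp
    · rw [← zpow_natCast, ← zpow_add]
      congr 1
      omega
  rw [mul_assoc _ _ (((∏ i, lastX r s p i) ^ (p - 1) : (LRing (r + p) (s + p))ˣ) :
    LRing (r + p) (s + p)), ← Units.val_mul, hlast] at h
  exact_mod_cast h

end Reduction

/-! ### Enumerations of the sets of a diagram -/

namespace Diagram

variable {p q : ℕ}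

/-- The elements of `A` in decreasing order. -/
def decrA (h : Diagram p q) (i : Fin p) : ℤ := h.A.orderEmbOfFin h.cardA i.rev

/-- The elements of `B` in increasing order. -/
def incrB (h : Diagram p q) (j : Fin q) : ℤ := h.B.orderEmbOfFin h.cardB j

theorem decrA_strictAnti (h : Diagram p q) : StrictAnti h.decrA := fun _ _ hij =>
  (h.A.orderEmbOfFin h.cardA).strictMono (Fin.rev_lt_rev.2 hij)

theorem incrB_strictMono (h : Diagram p q) : StrictMono h.incrB :=
  (h.B.orderEmbOfFin h.cardB).strictMono

theorem range_decrA (h : Diagram p q) : Set.range h.decrA = h.A := by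
  rw [← Finset.range_orderEmbOfFin h.A h.cardA]
  exact Fin.revPerm.surjective.range_comp (h.A.orderEmbOfFin h.cardA)

theorem range_incrB (h : Diagram p q) : Set.range h.incrB = h.B :=
  Finset.range_orderEmbOfFin h.B h.cardB

end Diagram

theorem exists_perm_comp_eq {N : ℕ} {h h' : Fin N → ℤ} (hh : Function.Injective h)
    (hh' : Function.Injective h') (hr : Set.range h = Set.range h') :
    ∃ σ : Equiv.Perm (Fin N), h ∘ σ = h' := by
  refine ⟨(Equiv.ofInjective h' hh').trans ((Equiv.setCongr hr.symm).trans
    (Equiv.ofInjective h hh).symm), funext fun i => ?_⟩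
  exact congrArg Subtype.val ((Equiv.ofInjective h hh).apply_symm_apply _)

section Block

variable {r s p : ℕ}

/-- The permutations `σ`, `τ` arrange the sets of `f` as those of `g` followed by a common
sequence with entries `≤ s - r`. -/
def IsArrangement (f : Diagram (r + p) (s + p)) (g : Diagram r s)
    (στ : Equiv.Perm (Fin (r + p)) × Equiv.Perm (Fin (s + p))) (c : Fin p → ℤ) : Prop :=
  f.decrA ∘ στ.1 = Fin.append g.decrA c ∧ f.incrB ∘ στ.2 = Fin.append g.incrB c ∧
    ∀ i, c i ≤ (s : ℤ) - r

theorem addRho_lam (f : Diagram (r + p) (s + p)) (i : Fin (r + p)) :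
    addRho f.lam i = f.decrA i + ((r : ℤ) + p - 1) := by
  rw [addRho, Diagram.lam, Diagram.decrA]
  push_cast
  ring

theorem addRho_mu (f : Diagram (r + p) (s + p)) (j : Fin (s + p)) :
    addRho f.mu j = (s : ℤ) - r - f.incrB j := by
  rw [addRho, Diagram.mu, Diagram.incrB]
  push_cast
  ring

theorem blockExpo_diagram (g : Diagram r s) :
    blockExpo p (fun i => g.lam i + ((r : ℤ) + p - 1 - i))
          (fun j => g.mu j + ((s : ℤ) - 1 - j)) ((s : ℤ) + p - 1) =
      blockExpo p (fun i => g.decrA i + ((r : ℤ) + p - 1)) (fun j => (s : ℤ) - r - g.incrB j)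
        ((s : ℤ) + p - 1) := by
  congr 1
  · ext i
    rw [Diagram.lam, Diagram.decrA]
    ring
  · ext i
    rw [Diagram.mu, Diagram.incrB]
    ring

theorem ratioExpo_eq_iff (f : Diagram (r + p) (s + p)) (g : Diagram r s)
    (στ : Equiv.Perm (Fin (r + p)) × Equiv.Perm (Fin (s + p))) (k : Fin p → ℕ) :
    ratioExpo r s k = -((blockExpo p (fun i => g.decrA i + ((r : ℤ) + p - 1))
        (fun j => (s : ℤ) - r - g.incrB j) ((s : ℤ) + p - 1)).1 - addRho f.lam ∘ στ.1,
        (blockExpo p (fun i => g.decrA i + ((r : ℤ) + p - 1))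
        (fun j => (s : ℤ) - r - g.incrB j) ((s : ℤ) + p - 1)).2 - addRho f.mu ∘ στ.2) ↔
      IsArrangement f g στ fun i => (s : ℤ) - r - k i := by
  rw [IsArrangement, Prod.ext_iff, funext_iff, funext_iff, funext_iff, funext_iff]
  simp only [Fin.forall_fin_add, ratioExpo, blockExpo, Prod.fst_neg, Prod.snd_neg, Pi.neg_apply,
    Pi.sub_apply, Fin.append_left, Fin.append_right, Pi.zero_apply, Function.comp_apply,
    addRho_lam, addRho_mu]
  constructor
  · rintro ⟨⟨h1, h2⟩, h3, h4⟩
    refine ⟨⟨fun i => ?_, fun i => ?_⟩, ⟨fun i => ?_, fun i => ?_⟩, fun i => ?_⟩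
    · linarith [h1 i]
    · linarith [h2 i]
    · linarith [h3 i]
    · linarith [h4 i]
    · linarith [(k i).cast_nonneg (α := ℤ)]
  · rintro ⟨⟨h1, h2⟩, ⟨h3, h4⟩, -⟩
    refine ⟨⟨fun i => ?_, fun i => ?_⟩, fun i => ?_, fun i => ?_⟩
    · linarith [h1 i]
    · linarith [h2 i]
    · linarith [h3 i]
    · linarith [h4 i]

theorem seriesTerm_of_isArrangement {f : Diagram (r + p) (s + p)} {g : Diagram r s}
    {στ : Equiv.Perm (Fin (r + p)) × Equiv.Perm (Fin (s + p))} {c : Fin p → ℤ}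
    (h : IsArrangement f g στ c) :
    seriesTerm (monoUnit ((blockExpo p (fun i => g.decrA i + ((r : ℤ) + p - 1))
        (fun j => (s : ℤ) - r - g.incrB j) ((s : ℤ) + p - 1)).1 - addRho f.lam ∘ στ.1,
        (blockExpo p (fun i => g.decrA i + ((r : ℤ) + p - 1))
        (fun j => (s : ℤ) - r - g.incrB j) ((s : ℤ) + p - 1)).2 - addRho f.mu ∘ στ.2) :
        LRing (r + p) (s + p)) (diagSeries r s p) =
      ((∑ i, ((s : ℤ) - r - c i)).negOnePow : ℤˣ) := by
  have hk : ∀ i, (((s : ℤ) - r - c i).toNat : ℤ) = (s : ℤ) - r - c i := fun i =>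
    Int.toNat_of_nonneg (by linarith [h.2.2 i])
  have hc : (fun i => (s : ℤ) - r - (((s : ℤ) - r - c i).toNat : ℤ)) = c := by
    ext i
    rw [hk]
    ring
  rw [seriesTerm_monoUnit_eq (k := fun i => ((s : ℤ) - r - c i).toNat)
    ((ratioExpo_eq_iff f g στ _).2 (hc.symm ▸ h))]
  have : ∑ i, ((s : ℤ) - r - c i) = ((∑ i, ((s : ℤ) - r - c i).toNat : ℕ) : ℤ) := by
    push_cast [hk]
    rfl
  rw [this, Int.coe_negOnePow_natCast]

theorem seriesTerm_of_not_isArrangement {f : Diagram (r + p) (s + p)} {g : Diagram r s}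
    {στ : Equiv.Perm (Fin (r + p)) × Equiv.Perm (Fin (s + p))}
    (h : ∀ c : Fin p → ℤ, ¬ IsArrangement f g στ c) :
    seriesTerm (monoUnit ((blockExpo p (fun i => g.decrA i + ((r : ℤ) + p - 1))
        (fun j => (s : ℤ) - r - g.incrB j) ((s : ℤ) + p - 1)).1 - addRho f.lam ∘ στ.1,
        (blockExpo p (fun i => g.decrA i + ((r : ℤ) + p - 1))
        (fun j => (s : ℤ) - r - g.incrB j) ((s : ℤ) + p - 1)).2 - addRho f.mu ∘ στ.2) :
        LRing (r + p) (s + p)) (diagSeries r s p) = 0 :=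
  seriesTerm_monoUnit_eq_zero fun k hk => h _ ((ratioExpo_eq_iff f g στ k).1 hk)

theorem append_comp_extendPerm (a : Fin r → ℤ) (c : Fin p → ℤ) (θ : Equiv.Perm (Fin p)) :
    Fin.append a c ∘ extendPerm r θ = Fin.append a (c ∘ θ) := by
  ext i
  refine Fin.addCases (fun i => ?_) (fun i => ?_) i
  · simp [extendPerm_castAdd]
  · simp [extendPerm_natAdd]

theorem extendPerm_injective : Function.Injective (extendPerm r : Equiv.Perm (Fin p) → _) := by
  intro θ θ' h
  ext1 i
  have := Equiv.congr_fun h (Fin.natAdd r i)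
  simpa [extendPerm_natAdd] using this

theorem append_injective_right {a : Fin r → ℤ} {c : Fin p → ℤ}
    (h : Function.Injective (Fin.append a c)) : Function.Injective c := by
  intro i j hij
  have := @h (Fin.natAdd r i) (Fin.natAdd r j) (by simpa using hij)
  simpa using this

theorem range_append_right {a : Fin r → ℤ} {c : Fin p → ℤ}
    (h : Function.Injective (Fin.append a c)) :
    Set.range c = Set.range (Fin.append a c) \ Set.range a := by
  ext z
  constructor
  · rintro ⟨i, rfl⟩
    refine ⟨⟨Fin.natAdd r i, by simp⟩, ?_⟩
    rintro ⟨j, hj⟩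
    have := @h (Fin.castAdd p j) (Fin.natAdd r i) (by simpa using hj)
    have := congrArg Fin.val this
    simp at this
    have := j.2
    omega
  · rintro ⟨⟨i, rfl⟩, hi⟩
    revert hi
    refine Fin.addCases (fun i hi => ?_) (fun i _ => ?_) i
    · exact (hi ⟨i, by simp⟩).elim
    · exact ⟨i, by simp⟩

namespace IsArrangement

variable {f : Diagram (r + p) (s + p)} {g : Diagram r s}
  {στ στ' : Equiv.Perm (Fin (r + p)) × Equiv.Perm (Fin (s + p))} {c c' : Fin p → ℤ}

theorem injective_append_decrA (h : IsArrangement f g στ c) :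
    Function.Injective (Fin.append g.decrA c) :=
  h.1 ▸ f.decrA_strictAnti.injective.comp στ.1.injective

theorem injective_append_incrB (h : IsArrangement f g στ c) :
    Function.Injective (Fin.append g.incrB c) :=
  h.2.1 ▸ f.incrB_strictMono.injective.comp στ.2.injective

theorem range_append_decrA (h : IsArrangement f g στ c) :
    Set.range (Fin.append g.decrA c) = f.A := by
  rw [← h.1, στ.1.surjective.range_comp, f.range_decrA]

theorem range_append_incrB (h : IsArrangement f g στ c) :
    Set.range (Fin.append g.incrB c) = f.B := by
  rw [← h.2.1, στ.2.surjective.range_comp, f.range_incrB]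

theorem injective (h : IsArrangement f g στ c) : Function.Injective c :=
  append_injective_right h.injective_append_decrA

theorem range_eq (h : IsArrangement f g στ c) : Set.range c = (f.A : Set ℤ) \ g.A := by
  rw [range_append_right h.injective_append_decrA, h.range_append_decrA, g.range_decrA]

theorem range_eq' (h : IsArrangement f g στ c) : Set.range c = (f.B : Set ℤ) \ g.B := by
  rw [range_append_right h.injective_append_incrB, h.range_append_incrB, g.range_incrB]

theorem mul_extendPerm (h : IsArrangement f g στ c) (θ : Equiv.Perm (Fin p)) :
    IsArrangement f g (στ.1 * extendPerm r θ, στ.2 * extendPerm s θ) (c ∘ θ) := by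
  refine ⟨?_, ?_, fun i => h.2.2 _⟩
  · rw [← append_comp_extendPerm, ← h.1]
    rfl
  · rw [← append_comp_extendPerm, ← h.2.1]
    rfl

theorem exists_extendPerm (h : IsArrangement f g στ c) (h' : IsArrangement f g στ' c') :
    ∃ θ : Equiv.Perm (Fin p), c' = c ∘ θ ∧
      στ' = (στ.1 * extendPerm r θ, στ.2 * extendPerm s θ) := by
  obtain ⟨θ, hθ⟩ := exists_perm_comp_eq h.injective h'.injective
    (h.range_eq.trans h'.range_eq.symm)
  subst hθ
  have hm := h.mul_extendPerm θ
  refine ⟨θ, rfl, Prod.ext (Equiv.ext fun i => ?_) (Equiv.ext fun i => ?_)⟩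
  · exact f.decrA_strictAnti.injective (congrFun (h'.1.trans hm.1.symm) i)
  · exact f.incrB_strictMono.injective (congrFun (h'.2.1.trans hm.2.1.symm) i)

end IsArrangement

theorem factorial_mul_pairing_eq_sum (hr : r ≤ r + p) (hs : s ≤ s + p)
    (f : Diagram (r + p) (s + p)) (g : Diagram r s) :
    (p.factorial : ℚ) * pairing (chK f) (chE (r + p) (s + p) hr hs g) =
      ((∑ στ : Equiv.Perm (Fin (r + p)) × Equiv.Perm (Fin (s + p)),
        ((Equiv.Perm.sign στ.1 * Equiv.Perm.sign στ.2 : ℤˣ) : ℤ) *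
        seriesTerm (monoUnit ((blockExpo p (fun i => g.decrA i + ((r : ℤ) + p - 1))
        (fun j => (s : ℤ) - r - g.incrB j) ((s : ℤ) + p - 1)).1 - addRho f.lam ∘ στ.1,
        (blockExpo p (fun i => g.decrA i + ((r : ℤ) + p - 1))
        (fun j => (s : ℤ) - r - g.incrB j) ((s : ℤ) + p - 1)).2 - addRho f.mu ∘ στ.2) :
        LRing (r + p) (s + p)) (diagSeries r s p) : ℤ) : ℚ) := by
  rw [factorial_mul_pairing, blockExpo_diagram, seriesTerm_dualAlternant_mul_monoUnit,
    Fintype.sum_prod_type]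

theorem pairing_eq_zero_of_not_isArrangement (hr : r ≤ r + p) (hs : s ≤ s + p)
    {f : Diagram (r + p) (s + p)} {g : Diagram r s} (h : ∀ στ c, ¬ IsArrangement f g στ c) :
    pairing (chK f) (chE (r + p) (s + p) hr hs g) = 0 := by
  have hp : (p.factorial : ℚ) ≠ 0 := by positivity
  refine mul_left_cancel₀ hp ?_
  rw [factorial_mul_pairing_eq_sum, mul_zero, Int.cast_eq_zero]
  refine Finset.sum_eq_zero fun στ _ => ?_
  rw [seriesTerm_of_not_isArrangement (h στ), mul_zero]

theorem pairing_of_isArrangement (hr : r ≤ r + p) (hs : s ≤ s + p)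
    {f : Diagram (r + p) (s + p)} {g : Diagram r s}
    {στ : Equiv.Perm (Fin (r + p)) × Equiv.Perm (Fin (s + p))} {c : Fin p → ℤ}
    (h : IsArrangement f g στ c) :
    pairing (chK f) (chE (r + p) (s + p) hr hs g) =
      ((Equiv.Perm.sign στ.1 * Equiv.Perm.sign στ.2 *
        (∑ i, ((s : ℤ) - r - c i)).negOnePow : ℤˣ) : ℤ) := by
  classical
  have hp : (p.factorial : ℚ) ≠ 0 := by positivity
  refine mul_left_cancel₀ hp ?_
  rw [factorial_mul_pairing_eq_sum]
  have hinj : Function.Injective fun θ : Equiv.Perm (Fin p) =>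
      (στ.1 * extendPerm r θ, στ.2 * extendPerm s θ) := fun θ θ' hθ =>
    extendPerm_injective (mul_left_cancel (congrArg Prod.fst hθ))
  rw [← Finset.sum_subset (Finset.subset_univ (Finset.univ.map ⟨_, hinj⟩)), Finset.sum_map]
  · have hterm : ∀ θ : Equiv.Perm (Fin p), ∑ i, ((s : ℤ) - r - (c ∘ θ) i) =
        ∑ i, ((s : ℤ) - r - c i) := fun θ =>
      Equiv.sum_comp θ fun i => (s : ℤ) - r - c i
    have hval := fun θ => seriesTerm_of_isArrangement (h.mul_extendPerm θ)
    simp only [hterm] at hval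
    have hsign : ∀ θ : Equiv.Perm (Fin p),
        Equiv.Perm.sign (στ.1 * extendPerm r θ) * Equiv.Perm.sign (στ.2 * extendPerm s θ) =
          Equiv.Perm.sign στ.1 * Equiv.Perm.sign στ.2 := fun θ => by
      rw [map_mul, map_mul, sign_extendPerm, sign_extendPerm, mul_mul_mul_comm,
        Int.units_mul_self, mul_one]
    simp only [Function.Embedding.coeFn_mk, hval, hsign]
    simp [Fintype.card_perm]
  · intro στ' _ h'
    rw [seriesTerm_of_not_isArrangement, mul_zero]
    intro c' hc'
    obtain ⟨θ, -, hθ⟩ := h.exists_extendPerm hc'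
    exact h' (Finset.mem_map.2 ⟨θ, Finset.mem_univ _, hθ.symm⟩)

end Block

/-! ### Signs -/

section Sign

variable {N k l : ℕ}

/-- The sign of the permutation that puts a sequence into decreasing order, as a product over
pairs of positions. -/
def inversionSign (h : Fin N → ℤ) : ℤˣ := ∏ i, ∏ j, if i < j ∧ h i < h j then -1 else 1

theorem prod_ite_lt_and (P : Fin N → Fin N → Prop) [∀ i j, Decidable (P i j)] :
    ∏ i, ∏ j, (if i < j ∧ P i j then -1 else 1 : ℤˣ) =
      ∏ i, ∏ j ∈ Finset.Ioi i, if P i j then -1 else 1 := by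
  refine Finset.prod_congr rfl fun i _ => ?_
  rw [← Finset.filter_lt_eq_Ioi, Finset.prod_filter]
  exact Finset.prod_congr rfl fun j _ => ite_and _ _ _ _

theorem inversionSign_strictAnti {h : Fin N → ℤ} (hh : StrictAnti h) : inversionSign h = 1 :=
  Finset.prod_eq_one fun _ _ => Finset.prod_eq_one fun _ _ =>
    if_neg fun H => lt_asymm H.2 (hh H.1)

theorem inversionSign_strictAnti_comp {h : Fin N → ℤ} (hh : StrictAnti h)
    (σ : Equiv.Perm (Fin N)) : inversionSign (h ∘ σ) = Equiv.Perm.sign σ := by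
  rw [inversionSign, prod_ite_lt_and, Equiv.Perm.sign_eq_prod_prod_Ioi]
  refine Finset.prod_congr rfl fun i _ => Finset.prod_congr rfl fun j hj => ?_
  have hne : σ i ≠ σ j := σ.injective.ne (Finset.mem_Ioi.1 hj).ne
  simp only [Function.comp_apply, hh.lt_iff_gt]
  rcases lt_or_gt_of_ne hne with h | h <;> simp [h, h.not_gt]

theorem inversionSign_strictMono_comp {h : Fin N → ℤ} (hh : StrictMono h)
    (σ : Equiv.Perm (Fin N)) :
    inversionSign (h ∘ σ) = Equiv.Perm.sign σ * inversionSign h := by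
  rw [inversionSign, inversionSign, prod_ite_lt_and, prod_ite_lt_and,
    Equiv.Perm.sign_eq_prod_prod_Ioi, ← Finset.prod_mul_distrib]
  refine Finset.prod_congr rfl fun i _ => ?_
  rw [← Finset.prod_mul_distrib]
  refine Finset.prod_congr rfl fun j hj => ?_
  simp only [Function.comp_apply, hh.lt_iff_lt, Finset.mem_Ioi.1 hj, if_true]
  split_ifs <;> simp

theorem negOnePow_triangle_succ (N : ℕ) :
    ((((N + 1 : ℕ) : ℤ) * (((N + 1 : ℕ) : ℤ) - 1)) / 2).negOnePow =
      ((N : ℤ) * ((N : ℤ) - 1) / 2).negOnePow * (-1) ^ N := by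
  obtain ⟨t, ht⟩ := Int.even_mul_pred_self (N : ℤ)
  have h1 : (N : ℤ) * ((N : ℤ) - 1) / 2 = t := by omega
  have h2 : ((N + 1 : ℕ) : ℤ) * (((N + 1 : ℕ) : ℤ) - 1) / 2 = t + N := by
    have : ((N + 1 : ℕ) : ℤ) * (((N + 1 : ℕ) : ℤ) - 1) = (t + N) * 2 := by
      push_cast
      linarith
    rw [this, Int.mul_ediv_cancel _ two_ne_zero]
  rw [h1, h2, Int.negOnePow_add]
  rfl

theorem inversionSign_strictMono {h : Fin N → ℤ} (hh : StrictMono h) :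
    inversionSign h = ((N : ℤ) * ((N : ℤ) - 1) / 2).negOnePow := by
  induction N with
  | zero => simp [inversionSign]
  | succ N ih =>
    have h1 : StrictMono (h ∘ Fin.castSucc) := fun i j hij => hh (Fin.castSucc_lt_castSucc_iff.2 hij)
    rw [negOnePow_triangle_succ, ← ih h1, inversionSign, Fin.prod_univ_castSucc]
    simp only [Fin.prod_univ_castSucc]
    rw [Finset.prod_mul_distrib]
    have h2 : ∀ i : Fin N, h i.castSucc < h (Fin.last N) := fun i =>
      hh (Fin.castSucc_lt_last i)
    have h3 : ∀ i : Fin N, ¬ Fin.last N < i.castSucc := fun i => (Fin.castSucc_lt_last i).not_gt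
    simp [h2, h3, inversionSign]

theorem inversionSign_append (a : Fin k → ℤ) (b : Fin l → ℤ) :
    inversionSign (Fin.append a b) = inversionSign a * inversionSign b *
      ∏ i, ∏ j, if a i < b j then -1 else 1 := by
  have h1 : ∀ (i : Fin k) (j : Fin l), Fin.castAdd l i < Fin.natAdd k j := fun i j => by
    rw [Fin.lt_def, Fin.val_castAdd, Fin.val_natAdd]
    have := i.2
    omega
  have h2 : ∀ (i : Fin k) (j : Fin l), ¬ Fin.natAdd k j < Fin.castAdd l i := fun i j =>
    (h1 i j).not_gt
  have h3 : ∀ i j : Fin k, Fin.castAdd l i < Fin.castAdd l j ↔ i < j := fun i j => Iff.rfl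
  have h4 : ∀ i j : Fin l, Fin.natAdd k i < Fin.natAdd k j ↔ i < j := fun i j => by
    rw [Fin.lt_def, Fin.lt_def, Fin.val_natAdd, Fin.val_natAdd, add_lt_add_iff_left]
  simp only [inversionSign, Fin.prod_univ_add, Fin.append_left, Fin.append_right, h1, h2, h3, h4,
    true_and, false_and, if_false, Finset.prod_const_one, Finset.prod_mul_distrib]
  ac_rfl

theorem prod_eq_of_range {M : Type*} [CommMonoid M] {h : Fin N → ℤ} (hh : Function.Injective h)
    {X : Finset ℤ} (hX : Set.range h = X) (F : ℤ → M) : ∏ i, F (h i) = ∏ z ∈ X, F z := by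
  have : Finset.univ.map ⟨h, hh⟩ = X := by
    rw [← Finset.coe_inj, ← hX]
    simp
  rw [← this, Finset.prod_map]
  rfl

theorem prod_prod_eq_of_range {a : Fin k → ℤ} (ha : Function.Injective a) {X : Finset ℤ}
    (hX : Set.range a = X) {b : Fin l → ℤ} (hb : Function.Injective b) {Y : Finset ℤ}
    (hY : Set.range b = Y) :
    ∏ i, ∏ j, (if a i < b j then -1 else 1 : ℤˣ) =
      ∏ z ∈ X, ∏ w ∈ Y, if z < w then -1 else 1 := by
  rw [← prod_eq_of_range ha hX]
  exact Finset.prod_congr rfl fun i _ => prod_eq_of_range hb hY fun w => if a i < w then -1 else 1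

theorem decr_strictAnti (X : Finset ℤ) : StrictAnti (decr X) := fun _ _ hij =>
  (X.orderEmbOfFin rfl).strictMono (Fin.rev_lt_rev.2 hij)

theorem range_decr (X : Finset ℤ) : Set.range (decr X) = X := by
  rw [← Finset.range_orderEmbOfFin X rfl]
  exact Fin.revPerm.surjective.range_comp (X.orderEmbOfFin rfl)

theorem append_injective {a : Fin k → ℤ} {b : Fin l → ℤ} (ha : Function.Injective a)
    (hb : Function.Injective b) (h : Disjoint (Set.range a) (Set.range b)) :
    Function.Injective (Fin.append a b) :=
  Fin.append_injective_iff.2 ⟨ha, hb, fun i j hij => Set.disjoint_left.1 h ⟨i, rfl⟩ ⟨j, hij.symm⟩⟩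

theorem range_append (a : Fin k → ℤ) (b : Fin l → ℤ) :
    Set.range (Fin.append a b) = Set.range a ∪ Set.range b := by
  ext z
  constructor
  · rintro ⟨i, rfl⟩
    refine Fin.addCases (fun i => ?_) (fun i => ?_) i
    · exact Or.inl ⟨i, by rw [Fin.append_left]⟩
    · exact Or.inr ⟨i, by rw [Fin.append_right]⟩
  · rintro (⟨i, rfl⟩ | ⟨i, rfl⟩)
    · exact ⟨Fin.castAdd l i, by rw [Fin.append_left]⟩
    · exact ⟨Fin.natAdd k i, by rw [Fin.append_right]⟩

theorem shuffleSign_eq {X Y : Finset ℤ} (h : Disjoint X Y) :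
    shuffleSign X Y = ∏ z ∈ X, ∏ w ∈ Y, if z < w then -1 else 1 := by
  rw [← prod_prod_eq_of_range (decr_strictAnti X).injective (range_decr X)
    (decr_strictAnti Y).injective (range_decr Y)]
  set u := Fin.append (decr X) (decr Y) with hu
  have hinj : Function.Injective u := append_injective (decr_strictAnti X).injective
    (decr_strictAnti Y).injective (by
      rw [range_decr, range_decr]
      exact Finset.disjoint_coe.2 h)
  set σ := Tuple.sort fun i => -(u i) with hσ
  have hanti : StrictAnti (u ∘ σ) := fun i j hij => by
    have h1 : -(u (σ i)) ≤ -(u (σ j)) := Tuple.monotone_sort (fun i => -(u i)) hij.le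
    exact lt_of_le_of_ne (neg_le_neg_iff.1 h1) fun h2 => hij.ne' (σ.injective (hinj h2))
  have h1 := inversionSign_strictAnti_comp hanti σ⁻¹
  have h2 : (u ∘ σ) ∘ (σ⁻¹ : Equiv.Perm _) = u := by
    ext i
    simp
  rw [h2, Equiv.Perm.sign_inv, hu, inversionSign_append, inversionSign_strictAnti
    (decr_strictAnti X), inversionSign_strictAnti (decr_strictAnti Y), one_mul, one_mul] at h1
  exact h1.symm

theorem prod_lt_mul_shuffleSign {X Y : Finset ℤ} (h : Disjoint X Y) :
    ∏ z ∈ Y, ∏ w ∈ X, (if z < w then -1 else 1 : ℤˣ) =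
      shuffleSign X Y * (-1) ^ (Y.card * X.card) := by
  rw [shuffleSign_eq h, Finset.prod_comm]
  have : ((-1) ^ (Y.card * X.card) : ℤˣ) = ∏ _z ∈ X, ∏ _w ∈ Y, (-1 : ℤˣ) := by
    simp [pow_mul]
  rw [this, ← Finset.prod_mul_distrib]
  refine Finset.prod_congr rfl fun z hz => ?_
  rw [← Finset.prod_mul_distrib]
  refine Finset.prod_congr rfl fun w hw => ?_
  rcases lt_or_gt_of_ne (Finset.disjoint_iff_ne.1 h z hz w hw) with h1 | h1 <;>
    simp [h1, h1.not_gt]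

end Sign

/-! ### Diagrams obtained by turning circles into crosses -/

namespace Diagram

variable {p q : ℕ}

theorem mem_A_iff (h : Diagram p q) (z : ℤ) :
    z ∈ h.A ↔ h.symbol z = Symbol.cross ∨ h.symbol z = Symbol.gt := by
  unfold symbol
  split_ifs <;> simp_all

theorem mem_B_iff (h : Diagram p q) (z : ℤ) :
    z ∈ h.B ↔ h.symbol z = Symbol.cross ∨ h.symbol z = Symbol.lt := by
  unfold symbol
  split_ifs <;> simp_all

theorem symbol_eq_circ_iff (h : Diagram p q) (z : ℤ) :
    h.symbol z = Symbol.circ ↔ z ∉ h.A ∧ z ∉ h.B := by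
  unfold symbol
  split_ifs <;> simp_all

end Diagram

section Block

variable {r s p : ℕ} {f : Diagram (r + p) (s + p)} {g : Diagram r s} {C : Finset ℤ}

theorem A_eq_union_of_star (h : f.symbol = star g.symbol C) (hC : ∀ c ∈ C, c ∉ g.A) :
    f.A = g.A.disjUnion C (Finset.disjoint_right.2 hC) := by
  ext z
  rw [Finset.mem_disjUnion, f.mem_A_iff, h, g.mem_A_iff, star]
  split_ifs with hz <;> simp [hz]

theorem B_eq_union_of_star (h : f.symbol = star g.symbol C) (hC : ∀ c ∈ C, c ∉ g.B) :
    f.B = g.B.disjUnion C (Finset.disjoint_right.2 hC) := by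
  ext z
  rw [Finset.mem_disjUnion, f.mem_B_iff, h, g.mem_B_iff, star]
  split_ifs with hz <;> simp [hz]

theorem exists_isArrangement (h : f.symbol = star g.symbol C)
    (hC : ∀ c ∈ C, g.symbol c = Symbol.circ ∧ c ≤ (s : ℤ) - r) :
    ∃ στ, ∃ c : Fin p → ℤ, IsArrangement f g στ c ∧ StrictAnti c ∧ Set.range c = C := by
  have hCA : ∀ c ∈ C, c ∉ g.A := fun c hc => ((g.symbol_eq_circ_iff c).1 (hC c hc).1).1
  have hCB : ∀ c ∈ C, c ∉ g.B := fun c hc => ((g.symbol_eq_circ_iff c).1 (hC c hc).1).2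
  have hA := A_eq_union_of_star h hCA
  have hB := B_eq_union_of_star h hCB
  have hcard : C.card = p := by
    have := congrArg Finset.card hA
    rw [Finset.card_disjUnion, f.cardA, g.cardA] at this
    omega
  set c : Fin p → ℤ := fun i => C.orderEmbOfFin hcard i.rev with hc
  have hanti : StrictAnti c := fun _ _ hij =>
    (C.orderEmbOfFin hcard).strictMono (Fin.rev_lt_rev.2 hij)
  have hrange : Set.range c = C := by
    rw [← Finset.range_orderEmbOfFin C hcard]
    exact Fin.revPerm.surjective.range_comp (C.orderEmbOfFin hcard)
  obtain ⟨σ, hσ⟩ := exists_perm_comp_eq f.decrA_strictAnti.injective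
    (append_injective g.decrA_strictAnti.injective hanti.injective (by
      rw [g.range_decrA, hrange]
      exact Finset.disjoint_coe.2 (Finset.disjoint_right.2 hCA)))
    (by rw [f.range_decrA, range_append, g.range_decrA, hrange, hA, Finset.coe_disjUnion])
  obtain ⟨τ, hτ⟩ := exists_perm_comp_eq f.incrB_strictMono.injective
    (append_injective g.incrB_strictMono.injective hanti.injective (by
      rw [g.range_incrB, hrange]
      exact Finset.disjoint_coe.2 (Finset.disjoint_right.2 hCB)))
    (by rw [f.range_incrB, range_append, g.range_incrB, hrange, hB, Finset.coe_disjUnion])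
  refine ⟨(σ, τ), c, ⟨hσ, hτ, fun i => (hC (c i) ?_).2⟩, hanti, hrange⟩
  rw [← Finset.mem_coe, ← hrange]
  exact ⟨i, rfl⟩

theorem IsArrangement.exists_star {στ : Equiv.Perm (Fin (r + p)) × Equiv.Perm (Fin (s + p))}
    {c : Fin p → ℤ} (h : IsArrangement f g στ c) :
    ∃ C : Finset ℤ, (∀ c ∈ C, g.symbol c = Symbol.circ ∧ c ≤ (s : ℤ) - r) ∧
      f.symbol = star g.symbol C := by
  have hmem : ∀ z, z ∈ Finset.univ.image c ↔ z ∈ Set.range c := fun z => by simp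
  have hA : ∀ z, z ∈ f.A ↔ z ∈ g.A ∨ z ∈ Set.range c := fun z => by
    rw [← Finset.mem_coe, ← h.range_append_decrA, range_append, g.range_decrA, Set.mem_union,
      Finset.mem_coe]
  have hB : ∀ z, z ∈ f.B ↔ z ∈ g.B ∨ z ∈ Set.range c := fun z => by
    rw [← Finset.mem_coe, ← h.range_append_incrB, range_append, g.range_incrB, Set.mem_union,
      Finset.mem_coe]
  refine ⟨Finset.univ.image c, fun z hz => ⟨(g.symbol_eq_circ_iff z).2 ⟨?_, ?_⟩, ?_⟩,
    funext fun z => ?_⟩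
  · rw [hmem, h.range_eq] at hz
    exact hz.2
  · rw [hmem, h.range_eq'] at hz
    exact hz.2
  · obtain ⟨i, rfl⟩ := (hmem z).1 hz
    exact h.2.2 i
  · by_cases hz : z ∈ Set.range c
    · simp only [star, hmem, hz, if_true, Diagram.symbol, hA, hB, or_true]
    · simp only [star, hmem, hz, if_false, Diagram.symbol, hA, hB, or_false]

theorem negOnePow_rearrange {r s p S S' : ℤ} (hS : S' = p * (s - r) - S) :
    (s * (s - 1) / 2 + (s + p) * (s + p - 1) / 2 + s * p + S').negOnePow =
      (r * (r - 1) / 2 + (r + p) * (r + p - 1) / 2 + s * (r + p - r) + S).negOnePow := by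
  rw [Int.negOnePow_eq_iff, hS]
  obtain ⟨t, ht⟩ := Int.even_mul_pred_self r
  obtain ⟨u, hu⟩ := Int.even_mul_pred_self s
  obtain ⟨v, hv⟩ := Int.even_mul_pred_self p
  have h1 : r * (r - 1) / 2 = t := by omega
  have h2 : s * (s - 1) / 2 = u := by omega
  have h3 : (r + p) * (r + p - 1) / 2 = t + v + r * p := by
    rw [show (r + p) * (r + p - 1) = (t + v + r * p) * 2 by linear_combination ht + hv,
      Int.mul_ediv_cancel _ two_ne_zero]
  have h4 : (s + p) * (s + p - 1) / 2 = u + v + s * p := by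
    rw [show (s + p) * (s + p - 1) = (u + v + s * p) * 2 by linear_combination hu + hv,
      Int.mul_ediv_cancel _ two_ne_zero]
  rw [h1, h2, h3, h4]
  exact ⟨u - t + s * p - r * p - S, by ring⟩

theorem pairing_of_star (hr : r ≤ r + p) (hs : s ≤ s + p) (h : f.symbol = star g.symbol C)
    (hC : ∀ c ∈ C, g.symbol c = Symbol.circ ∧ c ≤ (s : ℤ) - r) :
    pairing (chK f) (chE (r + p) (s + p) hr hs g) =
        ((((r : ℤ) * ((r : ℤ) - 1) / 2 + ((r + p : ℕ) : ℤ) * (((r + p : ℕ) : ℤ) - 1) / 2 +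
            (s : ℤ) * (((r + p : ℕ) : ℤ) - (r : ℤ)) + ∑ c ∈ C, c).negOnePow *
          shuffleSign g.A C * shuffleSign C g.B : ℤˣ) : ℤ) := by
  obtain ⟨στ, c, hστ, hanti, hrange⟩ := exists_isArrangement h hC
  have hCA : Disjoint g.A C := Finset.disjoint_right.2 fun c hc =>
    ((g.symbol_eq_circ_iff c).1 (hC c hc).1).1
  have hCB : Disjoint C g.B := Finset.disjoint_left.2 fun c hc =>
    ((g.symbol_eq_circ_iff c).1 (hC c hc).1).2
  have hcard : C.card = p := by
    have : Finset.univ.map ⟨c, hanti.injective⟩ = C := by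
      rw [← Finset.coe_inj, ← hrange]
      simp
    rw [← this, Finset.card_map, Finset.card_univ, Fintype.card_fin]
  have hσ : Equiv.Perm.sign στ.1 = shuffleSign g.A C := by
    rw [← inversionSign_strictAnti_comp f.decrA_strictAnti, hστ.1, inversionSign_append,
      inversionSign_strictAnti g.decrA_strictAnti, inversionSign_strictAnti hanti, one_mul, one_mul,
      prod_prod_eq_of_range g.decrA_strictAnti.injective g.range_decrA hanti.injective hrange,
      shuffleSign_eq hCA]
  have hτ : Equiv.Perm.sign στ.2 = ((s : ℤ) * ((s : ℤ) - 1) / 2 +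
      ((s : ℤ) + p) * ((s : ℤ) + p - 1) / 2 + (s : ℤ) * p).negOnePow * shuffleSign C g.B := by
    have h1 := inversionSign_strictMono_comp f.incrB_strictMono στ.2
    rw [hστ.2.1, inversionSign_append, inversionSign_strictMono g.incrB_strictMono,
      inversionSign_strictAnti hanti, mul_one, inversionSign_strictMono f.incrB_strictMono,
      prod_prod_eq_of_range g.incrB_strictMono.injective g.range_incrB hanti.injective hrange,
      prod_lt_mul_shuffleSign hCB, g.cardB, hcard] at h1
    have h2 : ((s : ℤ) * p).negOnePow = (-1) ^ (s * p) := by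
      rw [← Nat.cast_mul]
      rfl
    rw [Int.negOnePow_add, Int.negOnePow_add, h2]
    push_cast at h1
    calc Equiv.Perm.sign στ.2 = Equiv.Perm.sign στ.2 *
          (((s : ℤ) + p) * ((s : ℤ) + p - 1) / 2).negOnePow *
          (((s : ℤ) + p) * ((s : ℤ) + p - 1) / 2).negOnePow := by
            rw [mul_assoc, Int.units_mul_self, mul_one]
      _ = _ := by
        rw [← h1]
        ac_rfl
  have hsum : ∑ i, ((s : ℤ) - r - c i) = (p : ℤ) * ((s : ℤ) - r) - ∑ z ∈ C, z := by
    have : ∑ i, c i = ∑ z ∈ C, z := by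
      have : Finset.univ.map ⟨c, hanti.injective⟩ = C := by
        rw [← Finset.coe_inj, ← hrange]
        simp
      rw [← this, Finset.sum_map]
      rfl
    rw [Finset.sum_sub_distrib, this]
    simp [mul_sub]
  rw [pairing_of_isArrangement hr hs hστ, hσ, hτ]
  push_cast
  rw [← negOnePow_rearrange hsum, Int.negOnePow_add _ (∑ i, ((s : ℤ) - r - c i))]
  push_cast
  ring

end Block

end GLSuper

end

theorem mainTheorem2 {m n r s : ℕ} (hr : r ≤ m) (hs : s ≤ n)
    (hrs : (r : ℤ) - (s : ℤ) = (m : ℤ) - (n : ℤ))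
    (f : GLSuper.Diagram m n) (g : GLSuper.Diagram r s) :
    (GLSuper.pairing (GLSuper.chK f) (GLSuper.chE m n hr hs g) ≠ 0 ↔
      ∃ C : Finset ℤ, (∀ c ∈ C, g.symbol c = GLSuper.Symbol.circ ∧ c ≤ (n : ℤ) - (m : ℤ)) ∧
        f.symbol = GLSuper.star g.symbol C) ∧
    ∀ C : Finset ℤ, (∀ c ∈ C, g.symbol c = GLSuper.Symbol.circ ∧ c ≤ (n : ℤ) - (m : ℤ)) →
      f.symbol = GLSuper.star g.symbol C →
      GLSuper.pairing (GLSuper.chK f) (GLSuper.chE m n hr hs g) =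
        ((((r : ℤ) * ((r : ℤ) - 1) / 2 + (m : ℤ) * ((m : ℤ) - 1) / 2 +
            (s : ℤ) * ((m : ℤ) - (r : ℤ)) + ∑ c ∈ C, c).negOnePow *
          GLSuper.shuffleSign g.A C * GLSuper.shuffleSign C g.B : ℤˣ) : ℤ) := by
  obtain ⟨p, rfl⟩ := Nat.exists_eq_add_of_le hr
  obtain rfl : n = s + p := by omega
  have hsr : ((s + p : ℕ) : ℤ) - ((r + p : ℕ) : ℤ) = (s : ℤ) - r := by
    push_cast
    ring
  rw [hsr]
  refine ⟨⟨fun h => ?_, ?_⟩, fun C hC h => GLSuper.pairing_of_star hr hs h hC⟩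
  · by_contra hno
    refine h (GLSuper.pairing_eq_zero_of_not_isArrangement hr hs fun στ c hc => hno ?_)
    exact hc.exists_star
  · rintro ⟨C, hC, h⟩
    rw [GLSuper.pairing_of_star hr hs h hC]
    exact Int.cast_ne_zero.2 (Units.ne_zero _)
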